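/- **Setting.** Let $(\mathcal S,\mathcal A,P,R_0,\{R_j\}_{j=1}^q)$ be a constrained Markov decision process, $\eta$ an initial state distribution, $\gamma\in(0,1)$, $T\ge 1$, and $\{\pi_\theta\}_{\theta\in\mathbb R^d}$ a family of policies, $\pi_\theta(a|s)$ being the density of the action $a$ in state $s$ with respect to a fixed reference measure on $\mathcal A$ (e.g. counting or Lebesgue measure). With $\sigma_0=-1$ and $\sigma_j=1$ for $j\ge1$, let $V_j(\theta)=\mathbb E\big[\sigma_j\sum_{t=0}^T\gamma^tR_j(s_t,a_t,s_{t+1})\big]$, $0\le j\le q$, where $s_0\sim\eta$, $a_t\sim\pi_\theta(\cdot|s_t)$, $s_{t+1}\sim P(s_t,a_t,\cdot)$. The constrained RL problem is to minimize $V_0(\theta)$ subject to $V_j(\theta)\le0$, $j=1,\dots,q$. Fix $C>0$ and put $V_{q+1}(\theta)=\|\theta\|^2-C$, $\Theta=\{V_{q+1}\le0\}$, $\mathcal C=\{\theta: V_j(\theta)\le0,\ 1\le j\le q+1\}$. For $\alpha>0$ and $\beta:\mathbb R^d\to\mathbb R_{>0}$ let $\mathcal R(\theta)$ be the solution of $$\min_{\xi\in\mathbb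 R^d}\tfrac12\|\xi+\nabla V_0(\theta)\|^2\quad\text{s.t.}\quad \alpha V_j(\theta)+\nabla V_j(\theta)^\top\xi+\tfrac{\beta(\theta)}2\|\xi\|^2\le0,\quad 1\le j\le q+1.\qquad(\mathrm R)$$ **Algorithm (RSGF-RL).** A batch of independent offline episodes $[s_0,a_0,\dots,s_T,a_T,s_{T+1}]$ generated with policies from a given set $\Lambda$ is available, and $\theta_0$ is given. At iteration $i=0,1,2,\dots$, $N_i$ new episodes are generated with $\pi_{\theta_i}$ (independently, given the past), and a nonempty finite set $\mathcal J_i$ of the episodes obtained so far is selected, in an arbitrary way; let $\zeta_n$ be the policy that generated the $n$-th selected episode. With a bounded baseline $b:\mathcal S\to\mathbb R$ and $\chi_{a,s}(\theta)=\log\pi_\theta(a|s)$, set, for $0\le j\le q$, $$\widehat V_j(\theta_i)=\frac{\sigma_j}{|\mathcal J_i|}\sum_{n}\prod_{t=0}^T\frac{\pi_{\theta_i}(a^n_t|s^n_t)}{\zeta_n(a^n_t|s^n_t)}\sum_{t=0}^T\gamma^tR_j(s_t^n,a_t^n,s_{t+1}^n),$$ $$\widehat{\nabla V}_j(\theta_i)=\frac{\sigma_j}{|\mathcal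 J_i|}\sum_{n}\prod_{t=0}^T\frac{\pi_{\theta_i}(a^n_t|s^n_t)}{\zeta_n(a^n_t|s^n_t)}\sum_{t=0}^T\gamma^t\,\nabla\chi_{a_t^n,s_t^n}(\theta_i)\Big(\sum_{t'=t}^T\gamma^{t'-t}R_j(s_{t'}^n,a_{t'}^n,s_{t'+1}^n)-b(s_t^n)\Big).$$ Let $(\widehat{\mathrm R})$ be problem (R) at $\theta=\theta_i$ with $V_j,\nabla V_j$ replaced by these estimates for $j\le q$ (the constraint for $j=q+1$ is kept), let $\widehat{\mathcal R}(\theta_i)$ be its solution, and let $\theta_{i+1}=\theta_i+h_i\widehat{\mathcal R}(\theta_i)$ with stepsizes $h_i>0$. **Theorem (Almost sure convergence).** Assume: * *Regularity:* $V_0,\dots,V_{q+1}$ and $\beta$ are twice continuously differentiable. * *Constraint qualification in $\mathcal C$:* for every $\theta\in\mathcal C$ there is $\xi$ with $\nabla V_j(\theta)^\top\xi<0$ for all $j\in\{1,\dots,q+1\}$ with $V_j(\theta)=0$ (MFCQ), and (R) satisfies the constant-rank condition (CRC) at $(\theta,\mathcal R(\theta))$: for every set $I$ of constraints of (R) active there,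 the gradients in $\xi$ of the constraints in $I$ have constant rank for all parameters and decision variables near $(\theta,\mathcal R(\theta))$. * There is $\nu>0$ with $\pi_\theta(a|s)>\nu$ and $\zeta(a|s)>\nu$ for all $a,s$, $\theta\in\mathbb R^d$, $\zeta\in\Lambda$. * $R_0,\dots,R_q$ are bounded. * $\chi_{a,s}$ is $C^1$, and its gradient is bounded and Lipschitz in $\theta$, uniformly in $a,s$. 1. $V_{q+1}(\theta_0)\le0$. 2. For every $\theta\in\Theta\setminus\mathcal C$, Slater's condition holds for (R) (some $\xi$ satisfies all its constraints strictly), and (R) satisfies CRC at $(\theta,\mathcal R(\theta))$. 3. Almost surely, $(\widehat{\mathrm R})$ is feasible at every iteration. 4. Almost surely, $\|\mathcal R(\theta_i)-\widehat{\mathcal R}(\theta_i)\|\to0$. 5. $h_i\to0$ and $\sum_ih_i=\infty$; moreover, almost surely, $h_i\le1/\alpha$ and $h_i\le\beta(\theta_i)/2$ for all $i$. 6. If $d\ge3$, the set of values $V_0(\mathcal K)$ has empty interior in $\mathbb R$, where $\mathcal K$ is the set of KKT points of the RL problem restricted to $\Theta$, i.e. of the problem of minimizing $V_0$ subject to $V_1\le0,\dots,V_{q+1}\le0$.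 (This is automatic, for instance, if $V_0$ takes countably many values on $\mathcal K$, in particular if the KKT points are isolated, or, by Sard's theorem, if the $V_j$ are of class $C^d$.) Then, almost surely, the iterates $\theta_i$ converge to $\mathcal K$, i.e. $\mathcal K\neq\emptyset$ and $\operatorname{dist}(\theta_i,\mathcal K)\to0$. Moreover, every point of $\mathcal K$ with $\|\theta\|^2<C$ is a KKT point of the constrained RL problem itself. -/

import Mathlib

open MeasureTheory ProbabilityTheory Filter Topology

noncomputable section

namespace RSGF

/-! ### Nonlinear programming -/

section NonlinearProgramming

variable {ι E Z : Type*}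

/-- The set of points satisfying `g j x ≤ 0` for all `j`. -/
def feasibleSet (g : ι → E → ℝ) : Set E := {x | ∀ j, g j x ≤ 0}

/-- Slater's condition for the constraints `g j x ≤ 0`. -/
def SlaterCondition (g : ι → E → ℝ) : Prop := ∃ x, ∀ j, g j x < 0

/-- A minimizer of `f` over `s`; it is the unique one whenever there is exactly one. -/
def argminOver [Nonempty E] (f : E → ℝ) (s : Set E) : E :=
  Classical.epsilon fun x => x ∈ s ∧ IsMinOn f s x

variable [NormedAddCommGroup E] [InnerProductSpace ℝ E] [CompleteSpace E]

/-- The Mangasarian-Fromovitz constraint qualification at `x`. -/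
def MFCQ (g : ι → E → ℝ) (x : E) : Prop :=
  ∃ ξ : E, ∀ j, g j x = 0 → inner ℝ (gradient (g j) x) ξ < 0

/-- The constant-rank condition at `(x₀, z₀)` for the constraints `g j x z ≤ 0`, where `x` is the
decision variable and `z` is the parameter. -/
def ConstantRankCondition [TopologicalSpace Z] (g : ι → E → Z → ℝ) (x₀ : E) (z₀ : Z) : Prop :=
  ∃ N ∈ 𝓝 (x₀, z₀), ∀ I : Set ι, (∀ j ∈ I, g j x₀ z₀ = 0) →
    ∃ r : ℕ, ∀ p ∈ N, Set.finrank ℝ ((fun j => gradient (fun x => g j x p.2) p.1) '' I) = r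

/-- KKT points of the problem of minimizing `f` subject to `g j ≤ 0` for all `j`. -/
def IsKKTPoint [Fintype ι] (f : E → ℝ) (g : ι → E → ℝ) (x : E) : Prop :=
  ∃ u : ι → ℝ, gradient f x + ∑ j, u j • gradient (g j) x = 0 ∧
    ∀ j, g j x ≤ 0 ∧ 0 ≤ u j ∧ u j * g j x = 0

/-- The function `ξ ↦ a j + ⟨v j, ξ⟩ + (c / 2) ‖ξ‖²`. -/
def qcqpConstraint (a : ι → ℝ) (v : ι → E) (c : ℝ) (j : ι) (ξ : E) : ℝ :=
  a j + inner ℝ (v j) ξ + c / 2 * ‖ξ‖ ^ 2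

/-- The minimizer of `½ ‖ξ + v₀‖²` subject to `a j + ⟨v j, ξ⟩ + (c / 2) ‖ξ‖² ≤ 0` for all `j`
(for `c > 0` it is unique as soon as the constraints are feasible). -/
def qcqpSolution (v₀ : E) (a : ι → ℝ) (v : ι → E) (c : ℝ) : E :=
  argminOver (fun ξ => 1 / 2 * ‖ξ + v₀‖ ^ 2) (feasibleSet (qcqpConstraint a v c))

/-- The constraint functions of the program that defines the robust safe gradient flow, in the
decision variable `ξ` and the parameter `θ`. -/
def flowConstraint (α : ℝ) (β : E → ℝ) (g : ι → E → ℝ) (j : ι) (ξ θ : E) : ℝ :=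
  qcqpConstraint (fun k => α * g k θ) (fun k => gradient (g k) θ) (β θ) j ξ

/-- The robust safe gradient flow field for minimizing `f` subject to `g j ≤ 0`. -/
def flowField (α : ℝ) (β : E → ℝ) (f : E → ℝ) (g : ι → E → ℝ) (θ : E) : E :=
  qcqpSolution (gradient f θ) (fun k => α * g k θ) (fun k => gradient (g k) θ) (β θ)

end NonlinearProgramming

/-! ### Constrained Markov decision processes -/

section MDP

variable (S A : Type*) [MeasurableSpace S] [MeasurableSpace A]

/-- A constrained Markov decision process; `reward 0` is the reward, and `reward j` with `j ≠ 0`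
are the `q` costs. -/
structure CMDP (q : ℕ) where
  transition : Kernel (S × A) S
  markov : IsMarkovKernel transition
  reward : Fin (q + 1) → S → A → S → ℝ
  measurable_reward : ∀ j, Measurable fun p : S × A × S => reward j p.1 p.2.1 p.2.2

/-- A policy, given by the density `density s a` of the action `a` in the state `s` with respect
to a reference measure on actions (the counting measure for discrete actions, Lebesgue measure
for continuous ones). -/
structure Policy (ref : Measure A) where
  density : S → A → ℝ
  measurable_density : Measurable (Function.uncurry density)
  nonneg : ∀ s a, 0 ≤ density s a
  normalized : ∀ s, ∫⁻ a, ENNReal.ofReal (density s a) ∂ref = 1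

/-- A sequence `s₀, a₀, s₁, …, a_{n-1}, s_n` of states and actions. -/
abbrev Path (n : ℕ) : Type _ := (Fin (n + 1) → S) × (Fin n → A)

/-- An episode `s₀, a₀, s₁, …, a_T, s_{T+1}`. -/
abbrev Episode (T : ℕ) : Type _ := Path S A (T + 1)

variable {S A} {ref : Measure A}

/-- The distribution of the action given the state. -/
def Policy.kernel [SFinite ref] (p : Policy S A ref) : Kernel S A :=
  (Kernel.const S ref).withDensity fun s a => ENNReal.ofReal (p.density s a)

instance Policy.isMarkovKernel_kernel [SFinite ref] (p : Policy S A ref) :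
    IsMarkovKernel p.kernel := by
  refine ⟨fun s => ⟨?_⟩⟩
  have hm : Measurable (Function.uncurry fun s a => ENNReal.ofReal (p.density s a)) :=
    p.measurable_density.ennreal_ofReal
  rw [Policy.kernel, Kernel.withDensity_apply _ hm, withDensity_apply _ MeasurableSet.univ]
  simpa using p.normalized s

variable {q : ℕ}

/-- Given a path ending in the state `s`, draw an action `a` from the policy at `s` and then the
next state from the transition probability at `(s, a)`. -/
def stepKernel [SFinite ref] (M : CMDP S A q) (p : Policy S A ref) (n : ℕ) :
    Kernel (Path S A n) (A × S) :=
  (p.kernel ⊗ₖ M.transition).comap (fun x => x.1 (Fin.last n)) (by fun_prop)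

/-- Append an action and a state to a path. -/
def appendStep (n : ℕ) (x : Path S A n × (A × S)) : Path S A (n + 1) :=
  (Fin.snoc (α := fun _ => S) x.1.1 x.2.2, Fin.snoc (α := fun _ => A) x.1.2 x.2.1)

/-- The law of the path of length `n` with initial distribution `η` under the policy `p`. -/
def pathLaw [SFinite ref] (M : CMDP S A q) (η : Measure S) (p : Policy S A ref) :
    (n : ℕ) → Measure (Path S A n)
  | 0 => η.map fun s => (fun _ => s, Fin.elim0)
  | n + 1 => (pathLaw M η p n ⊗ₘ stepKernel M p n).map (appendStep n)

/-- The discounted sum `∑_{t=0}^{T} γ^t R_j(s_t, a_t, s_{t+1})` along an episode. -/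
def discountedSum (M : CMDP S A q) (γ : ℝ) {T : ℕ} (j : Fin (q + 1)) (e : Episode S A T) : ℝ :=
  ∑ t : Fin (T + 1), γ ^ (t : ℕ) * M.reward j (e.1 t.castSucc) (e.2 t) (e.1 t.succ)

/-- The sign `σ_0 = -1` and `σ_j = 1` for `j ≠ 0`. -/
def rewardSign (j : Fin (q + 1)) : ℝ := if j = 0 then -1 else 1

end MDP

/-- A constrained reinforcement learning problem over policies parameterized by `θ ∈ ℝᵈ`. -/
structure RLProblem (d q : ℕ) (S A : Type*) [MeasurableSpace S] [MeasurableSpace A] where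
  cmdp : CMDP S A q
  /-- the reference measure for the densities of the policies -/
  ref : Measure A
  sfinite_ref : SFinite ref
  /-- the distribution of the initial state -/
  initial : Measure S
  initial_prob : IsProbabilityMeasure initial
  discount : ℝ
  discount_pos : 0 < discount
  discount_lt_one : discount < 1
  horizon : ℕ
  horizon_pos : 0 < horizon
  policy : EuclideanSpace ℝ (Fin d) → Policy S A ref

namespace RLProblem

attribute [instance] RLProblem.sfinite_ref RLProblem.initial_prob CMDP.markov

variable {d q : ℕ} {S A : Type*} [MeasurableSpace S] [MeasurableSpace A]

/-- The law of an episode generated by the policy `p`. -/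
def episodeLaw (P : RLProblem d q S A) (p : Policy S A P.ref) :
    Measure (Episode S A P.horizon) :=
  pathLaw P.cmdp P.initial p (P.horizon + 1)

/-- The value functions: `V_0` is minus the expected discounted reward, and `V_j` with `j ≠ 0` is
the `j`-th expected discounted cost. -/
def value (P : RLProblem d q S A) (j : Fin (q + 1)) (θ : EuclideanSpace ℝ (Fin d)) : ℝ :=
  ∫ e, rewardSign j * discountedSum P.cmdp P.discount j e ∂P.episodeLaw (P.policy θ)

/-- The constraint functions `V_1, …, V_q` and `V_{q+1}(θ) = ‖θ‖² - C` (the last one). -/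
def constraint (P : RLProblem d q S A) (C : ℝ) :
    Fin (q + 1) → EuclideanSpace ℝ (Fin d) → ℝ :=
  Fin.snoc (α := fun _ => EuclideanSpace ℝ (Fin d) → ℝ)
    (fun j : Fin q => P.value j.succ) (fun θ => ‖θ‖ ^ 2 - C)

/-- The function `χ_{a,s}(θ) = log π_θ(a|s)`. -/
def logPolicy (P : RLProblem d q S A) (a : A) (s : S) (θ : EuclideanSpace ℝ (Fin d)) : ℝ :=
  Real.log ((P.policy θ).density s a)

/-- The KKT points of the RL problem in `Θ = {‖θ‖² ≤ C}`, i.e. of the problem of minimizing `V_0`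
subject to `V_j ≤ 0` for `j = 1, …, q` and `‖θ‖² ≤ C`. -/
def kktSet (P : RLProblem d q S A) (C : ℝ) : Set (EuclideanSpace ℝ (Fin d)) :=
  {θ | IsKKTPoint (P.value 0) (P.constraint C) θ}

/-! ### Off-policy estimates -/

/-- The importance sampling ratio of an episode generated by the policy `ζ`. -/
def ratio (P : RLProblem d q S A) (θ : EuclideanSpace ℝ (Fin d)) (ζ : Policy S A P.ref)
    (e : Episode S A P.horizon) : ℝ :=
  ∏ t : Fin (P.horizon + 1),
    (P.policy θ).density (e.1 t.castSucc) (e.2 t) / ζ.density (e.1 t.castSucc) (e.2 t)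

/-- The reward to go `∑_{t'=t}^{T} γ^{t'-t} R_j(s_{t'}, a_{t'}, s_{t'+1}) - b(s_t)`. -/
def rewardToGo (P : RLProblem d q S A) (b : S → ℝ) (j : Fin (q + 1)) (e : Episode S A P.horizon)
    (t : Fin (P.horizon + 1)) : ℝ :=
  (∑ t' ∈ Finset.Ici t, P.discount ^ ((t' : ℕ) - (t : ℕ)) *
    P.cmdp.reward j (e.1 t'.castSucc) (e.2 t') (e.1 t'.succ)) - b (e.1 t.castSucc)

variable {I : Type*}

/-- The estimate of `V_j(θ)` from the episodes `ep n`, `n ∈ J`, generated by the policies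
`beh n`. -/
def valueEstimate (P : RLProblem d q S A) (ep : I → Episode S A P.horizon)
    (beh : I → Policy S A P.ref) (J : Finset I) (j : Fin (q + 1))
    (θ : EuclideanSpace ℝ (Fin d)) : ℝ :=
  rewardSign j / (J.card : ℝ) *
    ∑ n ∈ J, P.ratio θ (beh n) (ep n) * discountedSum P.cmdp P.discount j (ep n)

/-- The estimate of `∇V_j(θ)` from the episodes `ep n`, `n ∈ J`, generated by the policies
`beh n`, with baseline function `b`. -/
def gradientEstimate (P : RLProblem d q S A) (b : S → ℝ) (ep : I → Episode S A P.horizon)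
    (beh : I → Policy S A P.ref) (J : Finset I) (j : Fin (q + 1))
    (θ : EuclideanSpace ℝ (Fin d)) : EuclideanSpace ℝ (Fin d) :=
  (rewardSign j / (J.card : ℝ)) •
    ∑ n ∈ J, P.ratio θ (beh n) (ep n) •
      ∑ t : Fin (P.horizon + 1), (P.discount ^ (t : ℕ) * P.rewardToGo b j (ep n) t) •
        gradient (P.logPolicy ((ep n).2 t) ((ep n).1 t.castSucc)) θ

/-- The constraint functions (in `ξ`) of the estimated program at `θ`: the first `q` use the
estimates, and the last one uses the known function `V_{q+1}(θ) = ‖θ‖² - C`. -/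
def estimatedConstraint (P : RLProblem d q S A) (α : ℝ) (β : EuclideanSpace ℝ (Fin d) → ℝ)
    (C : ℝ) (b : S → ℝ) (ep : I → Episode S A P.horizon) (beh : I → Policy S A P.ref)
    (J : Finset I) (θ : EuclideanSpace ℝ (Fin d)) :
    Fin (q + 1) → EuclideanSpace ℝ (Fin d) → ℝ :=
  qcqpConstraint
    (Fin.snoc (α := fun _ => ℝ) (fun j : Fin q => α * P.valueEstimate ep beh J j.succ θ)
      (α * (‖θ‖ ^ 2 - C)))
    (Fin.snoc (α := fun _ => EuclideanSpace ℝ (Fin d))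
      (fun j : Fin q => P.gradientEstimate b ep beh J j.succ θ)
      (gradient (fun x : EuclideanSpace ℝ (Fin d) => ‖x‖ ^ 2 - C) θ))
    (β θ)

/-- The estimated robust safe gradient flow field at `θ`. -/
def estimatedField (P : RLProblem d q S A) (α : ℝ) (β : EuclideanSpace ℝ (Fin d) → ℝ)
    (C : ℝ) (b : S → ℝ) (ep : I → Episode S A P.horizon) (beh : I → Policy S A P.ref)
    (J : Finset I) (θ : EuclideanSpace ℝ (Fin d)) : EuclideanSpace ℝ (Fin d) :=
  argminOver (fun ξ => 1 / 2 * ‖ξ + P.gradientEstimate b ep beh J 0 θ‖ ^ 2)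
    (feasibleSet (P.estimatedConstraint α β C b ep beh J θ))

/-! ### Standing assumptions -/

/-- The value functions and `β` are twice continuously differentiable. -/
def Regularity (P : RLProblem d q S A) (β : EuclideanSpace ℝ (Fin d) → ℝ) : Prop :=
  (∀ j, ContDiff ℝ 2 (P.value j)) ∧ ContDiff ℝ 2 β

/-- Constant-rank condition for the program defining the robust safe gradient flow, at
`(θ, R(θ))`. -/
def FlowConstantRank (P : RLProblem d q S A) (α : ℝ) (β : EuclideanSpace ℝ (Fin d) → ℝ) (C : ℝ)
    (θ : EuclideanSpace ℝ (Fin d)) : Prop :=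
  ConstantRankCondition (flowConstraint α β (P.constraint C))
    (flowField α β (P.value 0) (P.constraint C) θ) θ

/-- Constraint qualifications at every feasible point. -/
def FeasibleQualification (P : RLProblem d q S A) (α : ℝ) (β : EuclideanSpace ℝ (Fin d) → ℝ)
    (C : ℝ) : Prop :=
  ∀ θ ∈ feasibleSet (P.constraint C), MFCQ (P.constraint C) θ ∧ P.FlowConstantRank α β C θ

/-- Constraint qualifications at every infeasible point of `Θ = {‖θ‖² ≤ C}`. -/
def InfeasibleQualification (P : RLProblem d q S A) (α : ℝ) (β : EuclideanSpace ℝ (Fin d) → ℝ)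
    (C : ℝ) : Prop :=
  ∀ θ, ‖θ‖ ^ 2 ≤ C → θ ∉ feasibleSet (P.constraint C) →
    SlaterCondition (fun j ξ => flowConstraint α β (P.constraint C) j ξ θ) ∧
      P.FlowConstantRank α β C θ

/-- Uniform positive lower bound on the policies `π_θ` and on the policies `Λ` used offline. -/
def PoliciesBoundedBelow (P : RLProblem d q S A) {L : Type*} (Λ : L → Policy S A P.ref) : Prop :=
  ∃ ν : ℝ, 0 < ν ∧ ∀ a s, (∀ θ, ν < (P.policy θ).density s a) ∧ ∀ l, ν < (Λ l).density s a

/-- Boundedness of the reward and cost functions. -/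
def BoundedRewards (P : RLProblem d q S A) : Prop :=
  ∀ j, ∃ B : ℝ, 0 < B ∧ ∀ s a s', |P.cmdp.reward j s a s'| < B

/-- Differentiability of the log-policies, with bounded and Lipschitz gradients. -/
def RegularPolicies (P : RLProblem d q S A) : Prop :=
  (∀ a s, ContDiff ℝ 1 (P.logPolicy a s)) ∧
  (∃ L : ℝ, 0 < L ∧ ∀ θ θ' a s,
    ‖gradient (P.logPolicy a s) θ - gradient (P.logPolicy a s) θ'‖ ≤ L * ‖θ - θ'‖) ∧
  ∃ B : ℝ, 0 < B ∧ ∀ θ (l : Fin d) a s, |gradient (P.logPolicy a s) θ l| ≤ B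

/-! ### The algorithm -/

/-- The parameters of the algorithm. The type `L` indexes the policies used offline. -/
structure Params (P : RLProblem d q S A) (L : Type*) where
  α : ℝ
  α_pos : 0 < α
  β : EuclideanSpace ℝ (Fin d) → ℝ
  β_pos : ∀ θ, 0 < β θ
  /-- the constant in `V_{q+1}(θ) = ‖θ‖² - C` -/
  C : ℝ
  C_pos : 0 < C
  /-- the stepsizes -/
  h : ℕ → ℝ
  h_pos : ∀ i, 0 < h i
  /-- the baseline function -/
  b : S → ℝ
  measurable_b : Measurable b
  bounded_b : ∃ B : ℝ, 0 < B ∧ ∀ s, |b s| ≤ B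
  /-- the policies used offline -/
  Λ : L → Policy S A P.ref
  /-- the number of offline episodes generated with each of them -/
  Noff : L → ℕ
  /-- the number of episodes generated at each iteration -/
  N : ℕ → ℕ
  /-- the initial policy parameter -/
  θ₀ : EuclideanSpace ℝ (Fin d)

variable {L : Type*} {P : RLProblem d q S A}

/-- The labels of all episodes: `Sum.inl ⟨l, n⟩` is the `n`-th offline episode generated with the
policy `Λ l`, and `Sum.inr ⟨k, n⟩` is the `n`-th episode generated at iteration `k`. -/
abbrev Params.Label (Q : P.Params L) : Type _ :=
  (Σ l : L, Fin (Q.Noff l)) ⊕ (Σ k : ℕ, Fin (Q.N k))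

/-- The policy that generates the episode with a given label, when the iterates are `θ`. -/
def Params.behavior (Q : P.Params L) (θ : ℕ → EuclideanSpace ℝ (Fin d)) :
    Q.Label → Policy S A P.ref
  | Sum.inl z => Q.Λ z.1
  | Sum.inr z => P.policy (θ z.1)

/-- The constraint functions of the estimated program at iteration `i`, when the episodes are
`ep`, the iterates are `θ`, and `J` is the set of episodes selected at iteration `i`. -/
def Params.stepConstraint (Q : P.Params L) (ep : Q.Label → Episode S A P.horizon)
    (θ : ℕ → EuclideanSpace ℝ (Fin d)) (J : Finset Q.Label) (i : ℕ) :
    Fin (q + 1) → EuclideanSpace ℝ (Fin d) → ℝ :=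
  P.estimatedConstraint Q.α Q.β Q.C Q.b ep (Q.behavior θ) J (θ i)

/-- The direction computed by the algorithm at iteration `i`. -/
def Params.stepDirection (Q : P.Params L) (ep : Q.Label → Episode S A P.horizon)
    (θ : ℕ → EuclideanSpace ℝ (Fin d)) (J : Finset Q.Label) (i : ℕ) :
    EuclideanSpace ℝ (Fin d) :=
  P.estimatedField Q.α Q.β Q.C Q.b ep (Q.behavior θ) J (θ i)

/-- The exact robust safe gradient flow field with the constraints `V_1, …, V_{q+1}`. -/
def Params.field (Q : P.Params L) (θ : EuclideanSpace ℝ (Fin d)) : EuclideanSpace ℝ (Fin d) :=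
  flowField Q.α Q.β (P.value 0) (P.constraint Q.C) θ

/-- `ep`, `J`, `θ` are the episodes, the selected sets of episodes and the iterates of a run of the
algorithm on the probability space `(Ω, μ)`; `ℱ i` is the information available when iteration `i`
starts. The selection of the episodes is arbitrary. -/
structure IsRun (Q : P.Params L) {Ω : Type*} [mΩ : MeasurableSpace Ω] (μ : Measure Ω)
    (ℱ : Filtration ℕ mΩ) (ep : Q.Label → Ω → Episode S A P.horizon)
    (J : ℕ → Ω → Finset Q.Label) (θ : ℕ → Ω → EuclideanSpace ℝ (Fin d)) : Prop where
  init : ∀ ω, θ 0 ω = Q.θ₀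
  measurable_iterate : ∀ i, Measurable[ℱ i] (θ i)
  /-- the offline episodes are independent, generated with the policies `Λ` -/
  measurable_offline : ∀ z, Measurable[ℱ 0] (ep (Sum.inl z))
  law_offline : ∀ z : Σ l : L, Fin (Q.Noff l), μ.map (ep (Sum.inl z)) = P.episodeLaw (Q.Λ z.1)
  indep_offline : iIndepFun (fun z => ep (Sum.inl z)) μ
  /-- given the past, the episodes of iteration `i` are independent, generated with the current
  policy `π_{θ_i}` -/
  measurable_online : ∀ i n, Measurable[ℱ (i + 1)] (ep (Sum.inr ⟨i, n⟩))
  law_online : ∀ i, ∀ B : Set (Fin (Q.N i) → Episode S A P.horizon), MeasurableSet B →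
    μ[Set.indicator {ω | (fun n => ep (Sum.inr ⟨i, n⟩) ω) ∈ B} (fun _ => (1 : ℝ)) | ℱ i] =ᵐ[μ]
      fun ω => (Measure.pi fun _ : Fin (Q.N i) => P.episodeLaw (P.policy (θ i ω))).real B
  /-- a nonempty set of episodes, available at iteration `i`, is selected -/
  nonempty_selection : ∀ i ω, (J i ω).Nonempty
  available_selection : ∀ i ω k n, Sum.inr ⟨k, n⟩ ∈ J i ω → k ≤ i
  measurable_selection : ∀ i z, MeasurableSet[ℱ (i + 1)] {ω | z ∈ J i ω}
  update : ∀ i ω, θ (i + 1) ω = θ i ω +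
    Q.h i • Q.stepDirection (fun z => ep z ω) (fun k => θ k ω) (J i ω) i

end RLProblem

end RSGF

end

/-! The argument is pathwise. Outside a null set the iterates form a perturbed Euler scheme for the
field R, with direction errors tending to zero and steps of infinite sum; from there on everything
is deterministic.

The ball constraint of the estimated program, together with the stepsize bounds, keeps the iterates
in Θ (`Params.norm_sq_add_smul_stepDirection_le`), so compactness is available. On Θ the program (R)
satisfies Slater's condition, by MFCQ at feasible points and by assumption elsewhere. Hence R is
continuous on Θ (`continuousAt_qcqpSolution`) and its zeros there are KKT points
(`isKKTPoint_of_flowField_eq_zero`).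

Two inequalities drive the dynamics: ⟨∇V_j, R⟩ ≤ -αV_j on Θ, and ⟨∇V_0, R⟩ ≤ -‖R‖² at feasible
points. The first gives limsup V_j(θ_i) ≤ 0, so every cluster point is feasible; the second then
holds along the iterates up to a vanishing error. These errors need not be summable, so V_0(θ_i) is
not obviously convergent. It converges because the values of V_0 at the zeros of R have empty
interior: every interval contains a gap free of such values, and late iterates cannot cross a gap
upwards (`exists_tendsto_objective`). Finally, near a cluster point with R ≠ 0 the objective would
fall at a definite rate for infinite time, against its convergence (`eq_zero_of_mapClusterPt`).

In dimension at most two the empty interior is a theorem of Sard type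
(`interior_image_kkt_eq_empty`), for which C² data suffice. -/

namespace RSGF

/-! ### A Sard type theorem for KKT points in dimension at most two -/

section Sard

open scoped NNReal ENNReal

variable {E : Type*} [NormedAddCommGroup E] [InnerProductSpace ℝ E] [FiniteDimensional ℝ E]

/-- If the image of a neighbourhood in `s` of every point of `s` is null, then so is the image of
`s`. -/
lemma volume_image_eq_zero_of_locally {f : E → ℝ} {s : Set E}
    (h : ∀ x ∈ s, ∃ U ∈ 𝓝 x, volume (f '' (s ∩ U)) = 0) : volume (f '' s) = 0 := by
  have h' : (OuterMeasure.comap f (volume : Measure ℝ).toOuterMeasure) s = 0 := by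
    refine measure_null_of_locally_null s fun x hx => ?_
    obtain ⟨U, hU, h0⟩ := h x hx
    exact ⟨s ∩ U, inter_mem_nhdsWithin _ hU, by simpa using h0⟩
  simpa using h'

/-- A continuous linear functional that is injective on a given subspace of dimension at most
one. -/
lemma exists_functional_injective_on {W : Submodule ℝ E} (hW : Module.finrank ℝ W ≤ 1) :
    ∃ π : E →L[ℝ] ℝ, ∀ v ∈ W, π v = 0 → v = 0 := by
  obtain ⟨w, hw⟩ := finrank_le_one_iff.1 hW
  refine ⟨innerSL ℝ (w : E), fun v hv h0 => ?_⟩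
  obtain ⟨c, hc⟩ := hw ⟨v, hv⟩
  have hc' : c • (w : E) = v := congrArg Subtype.val hc
  rw [← hc'] at h0 ⊢
  simpa [inner_smul_right] using h0

variable {ι : Type*} [Fintype ι]

/-- If `f` is critical along the common zero set of `g`, and the differentials of `g` at `x₀`
vanish jointly only on a space of dimension at most one, then `f` takes few values near `x₀`. -/
lemma exists_nhds_volume_image_eq_zero {f : E → ℝ} {g : ι → E → ℝ} {s : Set E} {x₀ : E}
    (hf : Differentiable ℝ f) (hg : ∀ j, ContDiff ℝ 1 (g j))
    (hs : ∀ x ∈ s, ∀ j, g j x = 0)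
    (hspan : ∀ x ∈ s, ∃ u : ι → ℝ, fderiv ℝ f x = ∑ j, u j • fderiv ℝ (g j) x)
    {W : Submodule ℝ E} (hW : Module.finrank ℝ W ≤ 1)
    (hker : ∀ v, (∀ j, fderiv ℝ (g j) x₀ v = 0) → v ∈ W) :
    ∃ U ∈ 𝓝 x₀, volume (f '' (s ∩ U)) = 0 := by
  obtain ⟨π, hπ⟩ := exists_functional_injective_on hW
  have hgd : ∀ j, Differentiable ℝ (g j) := fun j => (hg j).differentiable one_ne_zero
  -- The derivative of (g, π) at x₀ is injective because π is injective on the joint kernel. So (g,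
  -- π) expands distances near x₀, and on s, where g = 0, the whole expansion is due to π.
  set Φ : E → (ι → ℝ) × ℝ := fun x => (fun j => g j x, π x) with hΦ
  set Φ' : E →L[ℝ] (ι → ℝ) × ℝ :=
    (ContinuousLinearMap.pi fun j => fderiv ℝ (g j) x₀).prod π with hΦ'
  have hstrict : HasStrictFDerivAt Φ Φ' x₀ := by
    refine HasStrictFDerivAt.prodMk ?_ π.hasStrictFDerivAt
    exact hasStrictFDerivAt_pi.2 fun j =>
      (hg j).contDiffAt.hasStrictFDerivAt one_ne_zero
  have hinj : Function.Injective Φ' := by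
    refine (injective_iff_map_eq_zero _).2 fun v hv => ?_
    have h1 : (fun j => fderiv ℝ (g j) x₀ v) = 0 := congrArg Prod.fst hv
    exact hπ v (hker v fun j => congrFun h1 j) (congrArg Prod.snd hv)
  obtain ⟨K, hK0, hK⟩ := (Φ' : E →ₗ[ℝ] (ι → ℝ) × ℝ).exists_antilipschitzWith
    (LinearMap.ker_eq_bot.2 hinj)
  have hKpos : (0 : ℝ) < K := by exact_mod_cast hK0
  -- The derivative expands by at least 1/K; an error of half that size can be absorbed, leaving the
  -- constant 2K below.
  have hev := hstrict.isLittleO.def (c := 1 / (2 * (K : ℝ))) (by positivity)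
  rw [nhds_prod_eq] at hev
  obtain ⟨U, hU, hUU⟩ := (eventually_prod_self_iff (r := fun x y =>
    ‖Φ x - Φ y - Φ' (x - y)‖ ≤ 1 / (2 * (K : ℝ)) * ‖x - y‖)).1 hev
  have hlip : ∀ x ∈ s ∩ U, ∀ y ∈ s ∩ U, ‖x - y‖ ≤ 2 * K * ‖π x - π y‖ := by
    intro x hx y hy
    have h1 : ‖Φ x - Φ y - Φ' (x - y)‖ ≤ 1 / (2 * (K : ℝ)) * ‖x - y‖ := hUU x hx.2 y hy.2
    have h2 : ‖x - y‖ ≤ K * ‖Φ' (x - y)‖ := by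
      have := hK.le_mul_dist (x - y) 0
      simpa [dist_eq_norm] using this
    have h3 : ‖Φ x - Φ y‖ = ‖π x - π y‖ := by
      have : Φ x - Φ y = (0, π x - π y) := by
        refine Prod.ext (funext fun j => ?_) rfl
        simp [hΦ, hs x hx.1 j, hs y hy.1 j]
      rw [this, Prod.norm_def]; simp
    have h4 : ‖Φ' (x - y)‖ ≤ ‖π x - π y‖ + 1 / (2 * (K : ℝ)) * ‖x - y‖ := by
      have := norm_sub_norm_le (Φ' (x - y)) (Φ x - Φ y)
      rw [norm_sub_rev (Φ' (x - y)), h3] at this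
      linarith
    have h5 : (K : ℝ) * (1 / (2 * (K : ℝ)) * ‖x - y‖) = ‖x - y‖ / 2 := by
      field_simp
    have h6 := mul_le_mul_of_nonneg_left h4 hKpos.le
    rw [mul_add, h5] at h6
    linarith
  refine ⟨U, hU, ?_⟩
  set t := s ∩ U
  -- By `hlip`, ψ is a Lipschitz parametrization of t by a subset of the line, which reduces the
  -- claim to one-dimensional Sard for f ∘ ψ.
  set ψ : ℝ → E := Function.invFunOn π t with hψ
  have hmem : ∀ z ∈ π '' t, ψ z ∈ t ∧ π (ψ z) = z := fun z hz =>
    ⟨Function.invFunOn_mem hz, Function.invFunOn_eq hz⟩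
  have himg : f '' t ⊆ (f ∘ ψ) '' (π '' t) := by
    rintro _ ⟨x, hx, rfl⟩
    have hz : π x ∈ π '' t := ⟨x, hx, rfl⟩
    refine ⟨π x, hz, ?_⟩
    have := hlip _ (hmem _ hz).1 x hx
    rw [(hmem _ hz).2, sub_self, norm_zero, mul_zero] at this
    simp [sub_eq_zero.1 (norm_le_zero_iff.1 this)]
  refine measure_mono_null himg ?_
  refine addHaar_image_eq_zero_of_det_fderivWithin_eq_zero volume
    (f' := fun _ => (0 : ℝ →L[ℝ] ℝ)) ?_ (fun _ _ => by simp [ContinuousLinearMap.det])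
  intro z hz
  obtain ⟨hzt, hzπ⟩ := hmem z hz
  obtain ⟨u, hu⟩ := hspan _ hzt.1
  have hO : (fun w => ψ w - ψ z) =O[𝓝[π '' t] z] fun w => w - z := by
    refine Asymptotics.IsBigO.of_bound (2 * K) ?_
    filter_upwards [self_mem_nhdsWithin] with w hw
    have := hlip _ (hmem w hw).1 _ hzt
    rwa [(hmem w hw).2, hzπ] at this
  have hcont : Tendsto ψ (𝓝[π '' t] z) (𝓝 (ψ z)) := by
    rw [← tendsto_sub_nhds_zero_iff]
    refine hO.trans_tendsto ?_
    rw [tendsto_sub_nhds_zero_iff]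
    exact tendsto_id.mono_left nhdsWithin_le_nhds
  -- This combination agrees with f on s and has zero derivative at ψ z, so f ∘ ψ has zero
  -- derivative within π '' t, whether or not that set is open.
  have hF : HasFDerivAt (fun x => f x - ∑ j, u j • g j x) (0 : E →L[ℝ] ℝ) (ψ z) := by
    have h1 : HasFDerivAt (fun x => ∑ j, u j • g j x) (∑ j, u j • fderiv ℝ (g j) (ψ z)) (ψ z) :=
      HasFDerivAt.fun_sum fun j _ => ((hgd j (ψ z)).hasFDerivAt.const_smul (u j))
    have h2 := (hf (ψ z)).hasFDerivAt.sub h1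
    rw [hu, sub_self] at h2
    exact h2
  have hlo := (hF.isLittleO.comp_tendsto hcont).trans_isBigO hO
  refine HasFDerivWithinAt.of_isLittleO ?_
  refine hlo.congr' ?_ EventuallyEq.rfl
  filter_upwards [self_mem_nhdsWithin] with w hw
  have h1 : ∀ x ∈ s, ∑ j, u j • g j x = 0 := fun x hx =>
    Finset.sum_eq_zero fun j _ => by simp [hs x hx j]
  simp only [Function.comp_apply, h1 _ (hmem w hw).1.1, h1 _ hzt.1, sub_zero, zero_apply]

/-- In dimension two, a `C²` function maps the points where its first two differentials vanish
to a null set. -/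
lemma volume_image_eq_zero_of_second_order {f : E → ℝ} (hf : ContDiff ℝ 2 f)
    (hE : Module.finrank ℝ E = 2) :
    volume (f '' {x | fderiv ℝ f x = 0 ∧ fderiv ℝ (fderiv ℝ f) x = 0}) = 0 := by
  borelize E
  set K := {x | fderiv ℝ f x = 0 ∧ fderiv ℝ (fderiv ℝ f) x = 0} with hK
  have hf1 : ContDiff ℝ 1 (fderiv ℝ f) := hf.fderiv_right (by norm_num)
  have hc2 : Continuous (fderiv ℝ (fderiv ℝ f)) := hf1.continuous_fderiv one_ne_zero
  have hfd : Differentiable ℝ f := hf.differentiable two_ne_zero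
  have hfd1 : Differentiable ℝ (fderiv ℝ f) := hf1.differentiable one_ne_zero
  have hKc : IsClosed K :=
    (isClosed_eq hf1.continuous continuous_const).inter (isClosed_eq hc2 continuous_const)
  -- On K the function is Hölder of exponent 2 with arbitrarily small constant: integrating the
  -- bound ε on the second differential twice from a point of K gives |f y - f z| ≤ ε |y - z|².
  have hloc : ∀ ε : ℝ≥0, 0 < ε → ∀ x : E, ∃ U : Set E, IsOpen U ∧ x ∈ U ∧
      HolderOnWith ε 2 f (K ∩ U) := by
    intro ε hε x
    by_cases hx : x ∈ K
    swap
    · exact ⟨Kᶜ, hKc.isOpen_compl, hx, by simp [HolderOnWith]⟩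
    have h1 : ∀ᶠ z in 𝓝 x, ‖fderiv ℝ (fderiv ℝ f) z‖ < ε := by
      have : Tendsto (fun z => ‖fderiv ℝ (fderiv ℝ f) z‖) (𝓝 x) (𝓝 0) := by
        have h0 : ‖fderiv ℝ (fderiv ℝ f) x‖ = 0 := by
          rw [hx.2]
          exact norm_zero (E := E →L[ℝ] E →L[ℝ] ℝ)
        have h1 : Continuous fun z => ‖fderiv ℝ (fderiv ℝ f) z‖ :=
          (hf1.continuous_fderiv one_ne_zero).norm
        simpa only [h0] using h1.tendsto x
      exact this.eventually_lt_const (by exact_mod_cast hε)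
    obtain ⟨r, hr, hball⟩ := Metric.eventually_nhds_iff_ball.1 h1
    refine ⟨Metric.ball x r, Metric.isOpen_ball, Metric.mem_ball_self hr, ?_⟩
    rintro y ⟨hyK, hy⟩ z ⟨-, hz⟩
    have hB : Convex ℝ (Metric.ball x r) := convex_ball x r
    have h2 : ∀ w ∈ segment ℝ y z, ‖fderiv ℝ f w‖ ≤ ε * ‖z - y‖ := by
      intro w hw
      have h3 := hB.norm_image_sub_le_of_norm_fderiv_le (𝕜 := ℝ) (f := fderiv ℝ f) (C := ε)
        (fun v _ => hfd1 v) (fun v hv => (hball v hv).le) hy (hB.segment_subset hy hz hw)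
      rw [hyK.1, sub_zero] at h3
      exact h3.trans (mul_le_mul_of_nonneg_left (norm_sub_le_of_mem_segment hw) ε.2)
    have h4 := (convex_segment y z).norm_image_sub_le_of_norm_fderiv_le (𝕜 := ℝ) (f := f)
      (fun v _ => hfd v) h2 (left_mem_segment ℝ y z) (right_mem_segment ℝ y z)
    have h5 : nndist (f y) (f z) ≤ ε * nndist y z ^ 2 := by
      rw [← NNReal.coe_le_coe]
      push_cast
      rw [dist_comm, dist_eq_norm, dist_comm y, dist_eq_norm, sq, ← mul_assoc]
      exact h4
    rw [edist_nndist, edist_nndist]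
    have h6 : (nndist y z : ℝ≥0∞) ^ ((2 : ℝ≥0) : ℝ) = (nndist y z : ℝ≥0∞) ^ 2 := by
      rw [NNReal.coe_ofNat, ENNReal.rpow_ofNat]
    rw [h6]
    exact_mod_cast h5
  have hbound : ∀ R : ℝ, ∀ ε : ℝ≥0, 0 < ε →
      volume (f '' (K ∩ Metric.ball 0 R)) ≤ ε * μH[(2 : ℝ)] (Metric.ball (0 : E) R) := by
    intro R ε hε
    choose U hUo hxU hU using hloc ε hε
    obtain ⟨t, htc, ht⟩ := TopologicalSpace.countable_cover_nhds
      (fun x => (hUo x).mem_nhds (hxU x))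
    have htne : t.Nonempty := by
      by_contra h
      rw [Set.not_nonempty_iff_eq_empty] at h
      simp only [h, Set.mem_empty_iff_false, Set.iUnion_of_empty, Set.iUnion_empty] at ht
      exact Set.empty_ne_univ ht
    obtain ⟨e, rfl⟩ := htc.exists_eq_range htne
    -- Disjoint pieces are needed so that their areas add up to at most that of the ball, however
    -- many neighbourhoods ε requires.
    set B : ℕ → Set E := disjointed fun n => U (e n) with hB
    have hBU : ⋃ n, B n = Set.univ := by
      rw [hB, iUnion_disjointed, ← ht, Set.biUnion_range]
    have hBm : ∀ n, MeasurableSet (B n) :=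
      MeasurableSet.disjointed fun n => (hUo (e n)).measurableSet
    have hBd : Pairwise (Function.onFun Disjoint B) := disjoint_disjointed _
    have hcov : f '' (K ∩ Metric.ball 0 R) ⊆ ⋃ n, f '' (K ∩ (Metric.ball 0 R ∩ B n)) := by
      rintro _ ⟨x, hx, rfl⟩
      obtain ⟨n, hn⟩ := Set.mem_iUnion.1 (hBU.symm ▸ Set.mem_univ x : x ∈ ⋃ n, B n)
      exact Set.mem_iUnion.2 ⟨n, x, ⟨hx.1, hx.2, hn⟩, rfl⟩
    have hpiece : ∀ n, volume (f '' (K ∩ (Metric.ball 0 R ∩ B n))) ≤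
        ε * μH[(2 : ℝ)] (Metric.ball 0 R ∩ B n) := by
      intro n
      have h1 : HolderOnWith ε 2 f (K ∩ (Metric.ball 0 R ∩ B n)) :=
        (hU (e n)).mono fun x hx => ⟨hx.1, disjointed_subset (fun n => U (e n)) n hx.2.2⟩
      have h2 := h1.hausdorffMeasure_image_le (by norm_num) zero_le_one
      rw [hausdorffMeasure_real, ENNReal.rpow_one, NNReal.coe_ofNat, mul_one] at h2
      exact h2.trans (mul_le_mul_right (measure_mono Set.inter_subset_right) _)
    calc volume (f '' (K ∩ Metric.ball 0 R))
        ≤ ∑' n, volume (f '' (K ∩ (Metric.ball 0 R ∩ B n))) :=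
          (measure_mono hcov).trans (measure_iUnion_le _)
      _ ≤ ∑' n, ε * μH[(2 : ℝ)] (Metric.ball 0 R ∩ B n) := ENNReal.tsum_le_tsum hpiece
      _ = ε * μH[(2 : ℝ)] (⋃ n, Metric.ball (0 : E) R ∩ B n) := by
          rw [ENNReal.tsum_mul_left, measure_iUnion]
          · exact fun i j hij => (hBd hij).mono Set.inter_subset_right Set.inter_subset_right
          · exact fun n => Metric.isOpen_ball.measurableSet.inter (hBm n)
      _ ≤ _ := by gcongr; exact Set.iUnion_subset fun n => Set.inter_subset_left
  -- In dimension two the two-dimensional Hausdorff measure is a Haar measure, hence finite on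
  -- balls, and ε can tend to zero.
  have hHaar : (μH[(2 : ℝ)] : Measure E).IsAddHaarMeasure := by
    have := MeasureTheory.isAddHaarMeasure_hausdorffMeasure (E := E)
    rwa [hE, Nat.cast_ofNat] at this
  have hzero : ∀ n : ℕ, volume (f '' (K ∩ Metric.ball 0 n)) = 0 := by
    intro n
    have hfin : μH[(2 : ℝ)] (Metric.ball (0 : E) n) ≠ ∞ := measure_ball_lt_top.ne
    have hlim : Tendsto (fun ε : ℝ≥0 => (ε : ℝ≥0∞) * μH[(2 : ℝ)] (Metric.ball (0 : E) n))
        (𝓝[>] 0) (𝓝 0) := by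
      have h1 : Tendsto (fun ε : ℝ≥0 => (ε : ℝ≥0∞)) (𝓝[>] 0) (𝓝 0) := by
        have : Tendsto (fun ε : ℝ≥0 => (ε : ℝ≥0∞)) (𝓝 0) (𝓝 ((0 : ℝ≥0) : ℝ≥0∞)) :=
          ENNReal.continuous_coe.tendsto 0
        rw [ENNReal.coe_zero] at this
        exact this.mono_left nhdsWithin_le_nhds
      simpa using ENNReal.Tendsto.mul_const h1 (Or.inr hfin)
    refine le_antisymm (ge_of_tendsto hlim ?_) zero_le
    filter_upwards [self_mem_nhdsWithin] with ε hε using hbound n ε hε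
  rw [← Set.inter_univ K, ← Metric.iUnion_ball_nat (0 : E), Set.inter_iUnion, Set.image_iUnion]
  exact measure_iUnion_null hzero

/-- The Morse-Sard theorem for real functions of class `C²` in dimension at most two. -/
lemma volume_image_critical_eq_zero {f : E → ℝ} (hf : ContDiff ℝ 2 f)
    (hE : Module.finrank ℝ E ≤ 2) : volume (f '' {x | fderiv ℝ f x = 0}) = 0 := by
  have hfd : Differentiable ℝ f := hf.differentiable two_ne_zero
  have hf1 : ContDiff ℝ 1 (fderiv ℝ f) := hf.fderiv_right (by norm_num)
  rcases hE.lt_or_eq with hE1 | hE2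
  -- In dimension at most one the kernel bound holds with no equations at all.
  · refine volume_image_eq_zero_of_locally fun x _ =>
      exists_nhds_volume_image_eq_zero (ι := Empty) (g := fun j => j.elim) (W := ⊤)
        hfd (fun j => j.elim) (fun _ _ j => j.elim) (fun y hy => ⟨0, by simpa using hy⟩) ?_ ?_
    · rw [finrank_top]; omega
    · simp
  have hsplit : {x | fderiv ℝ f x = 0} ⊆
      {x | fderiv ℝ f x = 0 ∧ fderiv ℝ (fderiv ℝ f) x = 0} ∪
        {x | fderiv ℝ f x = 0 ∧ fderiv ℝ (fderiv ℝ f) x ≠ 0} := fun x hx => by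
    by_cases h : fderiv ℝ (fderiv ℝ f) x = 0
    · exact Or.inl ⟨hx, h⟩
    · exact Or.inr ⟨hx, h⟩
  refine measure_mono_null (Set.image_mono hsplit) ?_
  rw [Set.image_union]
  refine measure_union_null (volume_image_eq_zero_of_second_order hf hE2) ?_
  refine volume_image_eq_zero_of_locally fun x hx => ?_
  set b := Module.finBasis ℝ E
  -- The equations are the partial derivatives of f. Their differentials vanish jointly on the
  -- kernel of the second differential, which is a proper subspace.
  refine exists_nhds_volume_image_eq_zero
    (g := fun j y => fderiv ℝ f y (b j)) (W := (fderiv ℝ (fderiv ℝ f) x).ker)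
    hfd (fun j => hf1.clm_apply contDiff_const) (fun y hy j => by simp [hy.1])
    (fun y hy => ⟨0, by simpa using hy.1⟩) ?_ ?_
  · have : (fderiv ℝ (fderiv ℝ f) x).ker < ⊤ := by
      refine lt_top_iff_ne_top.2 fun h => hx.2 ?_
      ext1 v
      have : v ∈ (fderiv ℝ (fderiv ℝ f) x).ker := h ▸ Submodule.mem_top
      exact this
    have := Submodule.finrank_lt_finrank_of_lt this
    rw [finrank_top] at this
    omega
  · intro v hv
    have hd : ∀ w, fderiv ℝ (fun y => fderiv ℝ f y w) x v = fderiv ℝ (fderiv ℝ f) x v w := by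
      intro w
      have h1 : HasFDerivAt (fun y => fderiv ℝ f y w)
          ((ContinuousLinearMap.apply ℝ ℝ w).comp (fderiv ℝ (fderiv ℝ f) x)) x :=
        (ContinuousLinearMap.apply ℝ ℝ w).hasFDerivAt.comp x
          (hf1.differentiable one_ne_zero x).hasFDerivAt
      rw [h1.fderiv]; rfl
    have : (fderiv ℝ (fderiv ℝ f) x v : E →ₗ[ℝ] ℝ) = 0 :=
      b.ext fun j => by simpa using (hd (b j)).symm.trans (hv j)
    change fderiv ℝ (fderiv ℝ f) x v = 0
    ext1 w
    exact LinearMap.congr_fun this w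

lemma inner_gradient {f : E → ℝ} {x : E} (v : E) :
    inner ℝ (gradient f x) v = fderiv ℝ f x v := by
  rw [← toDual_gradient, InnerProductSpace.toDual_apply_apply]

/-- In dimension at most two, the objective of a program with `C²` data takes few values on the
KKT points. -/
theorem interior_image_kkt_eq_empty {f : E → ℝ} {g : ι → E → ℝ} (hf : ContDiff ℝ 2 f)
    (hg : ∀ j, ContDiff ℝ 2 (g j)) (hE : Module.finrank ℝ E ≤ 2) :
    interior (f '' {x | IsKKTPoint f g x}) = ∅ := by
  classical
  refine Measure.interior_eq_empty_of_null (μ := volume) ?_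
  have hfd : Differentiable ℝ f := hf.differentiable two_ne_zero
  -- Only the active set and the linear relation between the differentials matter here; the signs of
  -- the multipliers and the inactive constraints are forgotten.
  set K : Finset ι → Set E := fun I => {x | (∀ j ∈ I, g j x = 0) ∧
    ∃ u : I → ℝ, fderiv ℝ f x = ∑ j, u j • fderiv ℝ (g j) x} with hK
  have hcov : {x | IsKKTPoint f g x} ⊆ ⋃ I, K I := by
    rintro x ⟨u, hu, hc⟩
    refine Set.mem_iUnion.2 ⟨Finset.univ.filter fun j => g j x = 0, by simp,
      fun j => -u j, ?_⟩
    ext v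
    have h1 := congrArg (fun w => inner ℝ w v) hu
    simp only [inner_add_left, sum_inner, inner_smul_left, inner_gradient, inner_zero_left] at h1
    have h2 : ∑ j, u j * fderiv ℝ (g j) x v =
        ∑ j ∈ Finset.univ.filter (fun j => g j x = 0), u j * fderiv ℝ (g j) x v := by
      refine (Finset.sum_subset (Finset.subset_univ _) fun j _ hj => ?_).symm
      have : u j = 0 := by
        have := (hc j).2.2
        simp only [Finset.mem_filter, Finset.mem_univ, true_and] at hj
        exact (mul_eq_zero.1 this).resolve_right hj
      simp [this]
    have h3 : ∑ j : {j // j ∈ Finset.univ.filter (fun j => g j x = 0)},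
        (-u j) * fderiv ℝ (g j) x v =
        ∑ j ∈ Finset.univ.filter (fun j => g j x = 0), (-u j) * fderiv ℝ (g j) x v :=
      Finset.sum_coe_sort (Finset.univ.filter (fun j => g j x = 0))
        (fun j => (-u j) * fderiv ℝ (g j) x v)
    simp only [RCLike.conj_to_real] at h1
    rw [sum_apply]
    simp only [smul_apply, smul_eq_mul]
    rw [h3]
    simp only [neg_mul, Finset.sum_neg_distrib]
    linarith
  refine measure_mono_null (Set.image_mono hcov) ?_
  rw [Set.image_iUnion]
  refine measure_iUnion_null fun I => ?_
  have hsplit : K I ⊆ {x | fderiv ℝ f x = 0} ∪ (K I ∩ {x | fderiv ℝ f x ≠ 0}) := fun x hx => by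
    by_cases h : fderiv ℝ f x = 0
    · exact Or.inl h
    · exact Or.inr ⟨hx, h⟩
  refine measure_mono_null (Set.image_mono hsplit) ?_
  rw [Set.image_union]
  refine measure_union_null (volume_image_critical_eq_zero hf hE) ?_
  refine volume_image_eq_zero_of_locally fun x hx => ?_
  refine exists_nhds_volume_image_eq_zero (ι := I) (g := fun j => g j)
    (W := ⨅ j : I, (fderiv ℝ (g j) x).ker) hfd
    (fun j => (hg j).of_le (by norm_num)) (fun y hy j => hy.1.1 j j.2) (fun y hy => hy.1.2) ?_ ?_
  -- Since the differential of f is nonzero and a combination of those of the g j, the latter do not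
  -- all vanish.
  · have : (⨅ j : I, (fderiv ℝ (g j) x).ker) < ⊤ := by
      refine lt_top_iff_ne_top.2 fun h => hx.2 ?_
      obtain ⟨u, hu⟩ := hx.1.2
      rw [hu]
      refine Finset.sum_eq_zero fun j _ => ?_
      have : fderiv ℝ (g j) x = 0 := by
        ext1 v
        have : v ∈ (fderiv ℝ (g j) x).ker := (iInf_eq_top.1 h j) ▸ Submodule.mem_top
        exact this
      rw [this, smul_zero]
    have := Submodule.finrank_lt_finrank_of_lt this
    rw [finrank_top] at this
    omega
  · intro v hv
    exact (Submodule.mem_iInf _).2 hv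

end Sard

/-! ### The quadratically constrained program -/

section QCQP

variable {ι E : Type*} [NormedAddCommGroup E] [InnerProductSpace ℝ E]

lemma argminOver_spec {X : Type*} [Nonempty X] {f : X → ℝ} {s : Set X}
    (h : ∃ x ∈ s, IsMinOn f s x) : argminOver f s ∈ s ∧ IsMinOn f s (argminOver f s) :=
  Classical.epsilon_spec h

lemma continuous_qcqpConstraint (a : ι → ℝ) (v : ι → E) (c : ℝ) (j : ι) :
    Continuous (qcqpConstraint a v c j) := by
  unfold qcqpConstraint
  fun_prop

lemma isClosed_feasibleSet_qcqp (a : ι → ℝ) (v : ι → E) (c : ℝ) :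
    IsClosed (feasibleSet (qcqpConstraint a v c)) := by
  simp only [feasibleSet, Set.ofPred_forall]
  exact isClosed_iInter fun j => isClosed_le (continuous_qcqpConstraint a v c j) continuous_const

lemma convexOn_qcqpConstraint (a : ι → ℝ) (v : ι → E) {c : ℝ} (hc : 0 ≤ c) (j : ι) :
    ConvexOn ℝ Set.univ (qcqpConstraint a v c j) := by
  have h1 : ConvexOn ℝ Set.univ fun ξ : E => inner ℝ (v j) ξ :=
    (innerSL ℝ (v j)).toLinearMap.convexOn convex_univ
  have h2 : ConvexOn ℝ Set.univ fun ξ : E => c / 2 * ‖ξ‖ ^ 2 :=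
    (convexOn_univ_norm.pow (fun _ _ => norm_nonneg _) 2).smul (by positivity)
  exact ((convexOn_const (a j) convex_univ).add h1).add h2

lemma convex_feasibleSet_qcqp (a : ι → ℝ) (v : ι → E) {c : ℝ} (hc : 0 ≤ c) :
    Convex ℝ (feasibleSet (qcqpConstraint a v c)) := by
  have : feasibleSet (qcqpConstraint a v c) =
      ⋂ j, {ξ | ξ ∈ Set.univ ∧ qcqpConstraint a v c j ξ ≤ 0} := by
    ext ξ; simp [feasibleSet]
  rw [this]
  exact convex_iInter fun j => (convexOn_qcqpConstraint a v hc j).convex_le 0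

/-- The objective is half the squared distance to -v₀, and a nonempty closed set in finite dimension
has a nearest point. So the choice in `argminOver` is a genuine minimizer. -/
lemma argminOver_half_sq_spec [FiniteDimensional ℝ E] {v₀ : E} {s : Set E} (hs : IsClosed s)
    (hne : s.Nonempty) :
    argminOver (fun ξ => 1 / 2 * ‖ξ + v₀‖ ^ 2) s ∈ s ∧
      ∀ ξ ∈ s, ‖argminOver (fun ξ => 1 / 2 * ‖ξ + v₀‖ ^ 2) s + v₀‖ ≤ ‖ξ + v₀‖ := by
  obtain ⟨y, hy, hmin⟩ := hs.exists_infDist_eq_dist hne (-v₀)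
  have hd : ∀ ξ, dist (-v₀) ξ = ‖ξ + v₀‖ := fun ξ => by
    rw [dist_comm, dist_eq_norm, sub_neg_eq_add]
  have hex : ∃ x ∈ s, IsMinOn (fun ξ => 1 / 2 * ‖ξ + v₀‖ ^ 2) s x := by
    refine ⟨y, hy, fun ξ hξ => ?_⟩
    have h := Metric.infDist_le_dist_of_mem (x := -v₀) hξ
    rw [hmin, hd, hd] at h
    change 1 / 2 * ‖y + v₀‖ ^ 2 ≤ 1 / 2 * ‖ξ + v₀‖ ^ 2
    gcongr
  obtain ⟨h1, h2⟩ := argminOver_spec hex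
  refine ⟨h1, fun ξ hξ => ?_⟩
  have h3 : 1 / 2 * ‖argminOver (fun ξ => 1 / 2 * ‖ξ + v₀‖ ^ 2) s + v₀‖ ^ 2 ≤
    1 / 2 * ‖ξ + v₀‖ ^ 2 := h2 hξ
  exact le_of_sq_le_sq (by linarith) (norm_nonneg _)

/-- The variational inequality that characterizes the point of a convex set closest to `-v₀`. -/
lemma inner_nonneg_of_forall_norm_le {v₀ z : E} {s : Set E} (hs : Convex ℝ s) (hz : z ∈ s)
    (hmin : ∀ ξ ∈ s, ‖z + v₀‖ ≤ ‖ξ + v₀‖) {ξ : E} (hξ : ξ ∈ s) :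
    0 ≤ inner ℝ (v₀ + z) (ξ - z) := by
  have h1 : ‖-v₀ - z‖ = ⨅ w : s, ‖-v₀ - w‖ := by
    have hd : ∀ w, ‖-v₀ - w‖ = ‖w + v₀‖ := fun w => by
      rw [← norm_neg]; congr 1; abel
    simp only [hd]
    have : Nonempty s := ⟨⟨z, hz⟩⟩
    refine le_antisymm (le_ciInf fun w => hmin w w.2) ?_
    exact ciInf_le ⟨0, by rintro _ ⟨w, rfl⟩; exact norm_nonneg _⟩ (⟨z, hz⟩ : s)
  have h2 := (norm_eq_iInf_iff_real_inner_le_zero hs hz).1 h1 ξ hξ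
  have h3 : -v₀ - z = -(v₀ + z) := by abel
  rw [h3, inner_neg_left] at h2
  linarith

/-- The variational inequalities at z and z', each tested at the other point, add up to 0 ≤ -‖z -
z'‖². -/
lemma eq_of_forall_norm_le {v₀ z z' : E} {s : Set E} (hs : Convex ℝ s) (hz : z ∈ s) (hz' : z' ∈ s)
    (hmin : ∀ ξ ∈ s, ‖z + v₀‖ ≤ ‖ξ + v₀‖) (hmin' : ∀ ξ ∈ s, ‖z' + v₀‖ ≤ ‖ξ + v₀‖) : z = z' := by
  have h1 := inner_nonneg_of_forall_norm_le hs hz hmin hz'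
  have h2 := inner_nonneg_of_forall_norm_le hs hz' hmin' hz
  have h3 : inner ℝ (v₀ + z) (z' - z) + inner ℝ (v₀ + z') (z - z') = -‖z - z'‖ ^ 2 := by
    rw [← real_inner_self_eq_norm_sq]
    simp only [inner_add_left, inner_sub_left, inner_sub_right, real_inner_comm z z']
    ring
  have h4 : ‖z - z'‖ ^ 2 ≤ 0 := by linarith
  exact sub_eq_zero.1 (norm_eq_zero.1 (pow_eq_zero_iff two_ne_zero |>.1
    (le_antisymm h4 (sq_nonneg _))))

/-- A direction that points inside at the active constraints gives strictly feasible points. -/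
lemma eventually_qcqpConstraint_smul_neg [Finite ι] {a : ι → ℝ} {v : ι → E} (c : ℝ) {ξ : E}
    (ha : ∀ j, a j ≤ 0) (hξ : ∀ j, a j = 0 → inner ℝ (v j) ξ < 0) :
    ∀ᶠ t : ℝ in 𝓝[>] 0, ∀ j, qcqpConstraint a v c j (t • ξ) < 0 := by
  refine eventually_all.2 fun j => ?_
  rcases (ha j).lt_or_eq with h | h
  · have h1 : Continuous fun t : ℝ => qcqpConstraint a v c j (t • ξ) :=
      (continuous_qcqpConstraint a v c j).comp (continuous_id.smul continuous_const)
    have h2 := h1.tendsto 0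
    have h3 : qcqpConstraint a v c j ((0 : ℝ) • ξ) = a j := by simp [qcqpConstraint]
    rw [h3] at h2
    exact (h2.mono_left nhdsWithin_le_nhds).eventually_lt_const h
  · have h1 : Continuous fun t : ℝ => inner ℝ (v j) ξ + c / 2 * t * ‖ξ‖ ^ 2 := by fun_prop
    have h2 := h1.tendsto 0
    simp only [mul_zero, zero_mul, add_zero] at h2
    filter_upwards [(h2.mono_left nhdsWithin_le_nhds).eventually_lt_const (hξ j h),
      self_mem_nhdsWithin] with t ht htpos
    have htpos' : (0 : ℝ) < t := htpos
    have h4 : qcqpConstraint a v c j (t • ξ) = t * (inner ℝ (v j) ξ + c / 2 * t * ‖ξ‖ ^ 2) := by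
      rw [qcqpConstraint, h, inner_smul_right, norm_smul, Real.norm_eq_abs, abs_of_pos htpos']
      ring
    rw [h4]
    exact mul_neg_of_pos_of_neg htpos' ht

variable [FiniteDimensional ℝ E]

lemma qcqpSolution_spec {v₀ : E} {a : ι → ℝ} {v : ι → E} {c : ℝ}
    (hne : (feasibleSet (qcqpConstraint a v c)).Nonempty) :
    qcqpSolution v₀ a v c ∈ feasibleSet (qcqpConstraint a v c) ∧
      ∀ ξ ∈ feasibleSet (qcqpConstraint a v c), ‖qcqpSolution v₀ a v c + v₀‖ ≤ ‖ξ + v₀‖ :=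
  argminOver_half_sq_spec (isClosed_feasibleSet_qcqp a v c) hne

/-- Under Slater's condition, the solution of the program depends continuously on the data. -/
lemma continuousAt_qcqpSolution [Finite ι] {X : Type*} [TopologicalSpace X] {x₀ : X} {v₀ : X → E}
    {a : X → ι → ℝ} {v : X → ι → E} {c : X → ℝ} (hv₀ : ContinuousAt v₀ x₀)
    (ha : ∀ j, ContinuousAt (fun x => a x j) x₀) (hv : ∀ j, ContinuousAt (fun x => v x j) x₀)
    (hc : ContinuousAt c x₀) (hc0 : 0 ≤ c x₀)
    (hslater : SlaterCondition (qcqpConstraint (a x₀) (v x₀) (c x₀))) :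
    ContinuousAt (fun x => qcqpSolution (v₀ x) (a x) (v x) (c x)) x₀ := by
  obtain ⟨ξ₁, hξ₁⟩ := hslater
  have hcont : ∀ (l : Filter X) (z : X → E) (ξ : E) (j : ι), l ≤ 𝓝 x₀ → Tendsto z l (𝓝 ξ) →
      Tendsto (fun x => qcqpConstraint (a x) (v x) (c x) j (z x)) l
        (𝓝 (qcqpConstraint (a x₀) (v x₀) (c x₀) j ξ)) := fun l z ξ j hl hz =>
    (((ha j).mono_left hl).add (((hv j).mono_left hl).inner hz)).add
      (((hc.mono_left hl).div_const 2).mul (hz.norm.pow 2))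
  have hev : ∀ ξ, (∀ j, qcqpConstraint (a x₀) (v x₀) (c x₀) j ξ < 0) →
      ∀ᶠ x in 𝓝 x₀, ξ ∈ feasibleSet (qcqpConstraint (a x) (v x) (c x)) := by
    intro ξ hξ
    filter_upwards [eventually_all.2 fun j =>
      (hcont (𝓝 x₀) _ ξ j le_rfl tendsto_const_nhds).eventually_lt_const (hξ j)] with x hx j
    exact (hx j).le
  have hF : Convex ℝ (feasibleSet (qcqpConstraint (a x₀) (v x₀) (c x₀))) :=
    convex_feasibleSet_qcqp _ _ hc0
  have hsol := qcqpSolution_spec (v₀ := v₀ x₀)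
    (⟨ξ₁, fun j => (hξ₁ j).le⟩ : (feasibleSet (qcqpConstraint (a x₀) (v x₀) (c x₀))).Nonempty)
  set M : ℝ := ‖ξ₁ + v₀ x₀‖ + 1 + (‖v₀ x₀‖ + 1)
  -- Comparison with the Slater point ξ₁, still feasible for nearby data, bounds the solutions; it
  -- remains to identify their cluster points.
  refine (isCompact_closedBall (0 : E) M).tendsto_nhds_of_unique_mapClusterPt ?_ ?_
  · filter_upwards [hev ξ₁ hξ₁,
      (hv₀.norm).eventually_lt_const (lt_add_one ‖v₀ x₀‖),
      ((hv₀.const_add ξ₁).norm).eventually_lt_const (lt_add_one ‖ξ₁ + v₀ x₀‖)] with x h1 h2 h3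
    have h4 := (qcqpSolution_spec (v₀ := v₀ x) ⟨ξ₁, h1⟩).2 ξ₁ h1
    rw [mem_closedBall_zero_iff]
    have h5 := norm_sub_le (qcqpSolution (v₀ x) (a x) (v x) (c x) + v₀ x) (v₀ x)
    rw [add_sub_cancel_right] at h5
    linarith
  · intro z _ hz
    obtain ⟨U, hU, hUz⟩ := mapClusterPt_iff_ultrafilter.1 hz
    have hzF : z ∈ feasibleSet (qcqpConstraint (a x₀) (v x₀) (c x₀)) := by
      intro j
      refine le_of_tendsto (hcont U _ z j hU hUz) ?_
      filter_upwards [hU (hev ξ₁ hξ₁)] with x h1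
      exact (qcqpSolution_spec ⟨ξ₁, h1⟩).1 j
    have hstrict : ∀ ξ, (∀ j, qcqpConstraint (a x₀) (v x₀) (c x₀) j ξ < 0) →
        ‖z + v₀ x₀‖ ≤ ‖ξ + v₀ x₀‖ := by
      intro ξ hξ
      have hvU : Tendsto v₀ U (𝓝 (v₀ x₀)) := hv₀.mono_left hU
      refine le_of_tendsto_of_tendsto (hUz.add hvU).norm (hvU.const_add ξ).norm ?_
      filter_upwards [hU (hev ξ hξ)] with x h1
      exact (qcqpSolution_spec ⟨ξ, h1⟩).2 ξ h1
    refine eq_of_forall_norm_le hF hzF hsol.1 (fun ξ hξ => ?_) hsol.2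
    -- A feasible ξ may become infeasible for nearby data, so it is approached along the segment to
    -- ξ₁, whose points other than ξ are strictly feasible.
    have hlim : Tendsto (fun t : ℝ => ‖((1 - t) • ξ + t • ξ₁) + v₀ x₀‖) (𝓝[>] 0)
        (𝓝 ‖ξ + v₀ x₀‖) := by
      have h1 : Continuous fun t : ℝ => ‖((1 - t) • ξ + t • ξ₁) + v₀ x₀‖ := by fun_prop
      have h2 := h1.tendsto 0
      simp only [sub_zero, one_smul, zero_smul, add_zero] at h2
      exact h2.mono_left nhdsWithin_le_nhds
    refine ge_of_tendsto hlim ?_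
    filter_upwards [Ioo_mem_nhdsGT (zero_lt_one' ℝ)] with t ht
    refine hstrict _ fun j => ?_
    have h1 := (convexOn_qcqpConstraint (a x₀) (v x₀) hc0 j).2 (Set.mem_univ ξ)
      (Set.mem_univ ξ₁) (by linarith [ht.2] : 0 ≤ 1 - t) ht.1.le (by ring)
    have h2 := mul_nonpos_of_nonneg_of_nonpos (by linarith [ht.2] : 0 ≤ 1 - t) (hξ j)
    have h3 := mul_neg_of_pos_of_neg ht.1 (hξ₁ j)
    simp only [smul_eq_mul] at h1
    linarith

/-- Gordan's theorem of the alternative. -/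
lemma exists_forall_inner_neg_or_exists_weights {κ : Type*} [Fintype κ] (y : κ → E) :
    (∃ ξ : E, ∀ i, inner ℝ (y i) ξ < 0) ∨
      ∃ w : κ → ℝ, (∀ i, 0 ≤ w i) ∧ ∑ i, w i = 1 ∧ ∑ i, w i • y i = 0 := by
  classical
  set T : (κ → ℝ) →ₗ[ℝ] E := Fintype.linearCombination ℝ y with hT
  have hTapp : ∀ w, T w = ∑ i, w i • y i := fun w => Fintype.linearCombination_apply ℝ y w
  have hTc : Continuous T := T.continuous_of_finiteDimensional
  by_cases h0 : (0 : E) ∈ T '' stdSimplex ℝ κ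
  · obtain ⟨w, hw, hw0⟩ := h0
    exact Or.inr ⟨w, hw.1, hw.2, by rw [← hTapp, hw0]⟩
  · left
    -- The functional separating 0 from the compact convex hull of the y i is negative on each of
    -- them.
    obtain ⟨φ, u, h1, h2⟩ := geometric_hahn_banach_closed_point
      ((convex_stdSimplex ℝ κ).linear_image T) ((isCompact_stdSimplex ℝ κ).image hTc).isClosed h0
    rw [map_zero] at h2
    refine ⟨(InnerProductSpace.toDual ℝ E).symm φ, fun i => ?_⟩
    rw [real_inner_comm, InnerProductSpace.toDual_symm_apply]
    refine (h1 (y i) ⟨Pi.single i 1, single_mem_stdSimplex ℝ i, ?_⟩).trans h2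
    rw [hTapp]
    simp [Pi.single_apply]

end QCQP

/-! ### Dissipation properties and zeros of the flow field -/

section Flow

variable {ι E : Type*} [NormedAddCommGroup E] [InnerProductSpace ℝ E]
  [FiniteDimensional ℝ E] {α : ℝ} {β : E → ℝ} {f : E → ℝ} {g : ι → E → ℝ} {θ : E}

lemma continuous_gradient (hf : ContDiff ℝ 1 f) : Continuous (gradient f) :=
  (InnerProductSpace.toDual ℝ E).symm.continuous.comp (hf.continuous_fderiv one_ne_zero)

/-- A short enough step along an MFCQ direction is strictly feasible: the linear term beats the
quadratic one at active constraints, and inactive ones have slack. -/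
lemma slaterCondition_of_mfcq [Finite ι] (hα : 0 < α) (hθ : θ ∈ feasibleSet g) (h : MFCQ g θ) :
    SlaterCondition (fun j ξ => flowConstraint α β g j ξ θ) := by
  obtain ⟨ξ, hξ⟩ := h
  obtain ⟨t, ht⟩ := (eventually_qcqpConstraint_smul_neg (a := fun k => α * g k θ)
    (v := fun k => gradient (g k) θ) (β θ) (ξ := ξ)
    (fun j => mul_nonpos_of_nonneg_of_nonpos hα.le (hθ j))
    (fun j hj => hξ j ((mul_eq_zero.1 hj).resolve_left hα.ne'))).exists
  exact ⟨t • ξ, ht⟩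

lemma continuousAt_flowField [Finite ι] (hf : ContDiff ℝ 1 f) (hg : ∀ j, ContDiff ℝ 1 (g j))
    (hβ : Continuous β) (hβ0 : 0 ≤ β θ)
    (h : SlaterCondition (fun j ξ => flowConstraint α β g j ξ θ)) :
    ContinuousAt (flowField α β f g) θ :=
  continuousAt_qcqpSolution (continuous_gradient hf).continuousAt
    (fun j => (continuous_const.mul (hg j).continuous).continuousAt)
    (fun j => (continuous_gradient (hg j)).continuousAt) hβ.continuousAt hβ0 h

lemma flowField_spec (h : SlaterCondition (fun j ξ => flowConstraint α β g j ξ θ)) :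
    flowField α β f g θ ∈ feasibleSet (fun j ξ => flowConstraint α β g j ξ θ) ∧
      ∀ ξ ∈ feasibleSet (fun j ξ => flowConstraint α β g j ξ θ),
        ‖flowField α β f g θ + gradient f θ‖ ≤ ‖ξ + gradient f θ‖ := by
  obtain ⟨ξ, hξ⟩ := h
  exact qcqpSolution_spec ⟨ξ, fun j => (hξ j).le⟩

/-- Feasibility of the field in (R), with the nonnegative quadratic term dropped. -/
lemma inner_gradient_constraint_flowField_le (hβ0 : 0 ≤ β θ)
    (h : SlaterCondition (fun j ξ => flowConstraint α β g j ξ θ)) (j : ι) :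
    inner ℝ (gradient (g j) θ) (flowField α β f g θ) ≤ -(α * g j θ) := by
  have h1 := (flowField_spec (f := f) h).1 j
  simp only [flowConstraint, qcqpConstraint] at h1
  have : 0 ≤ β θ / 2 * ‖flowField α β f g θ‖ ^ 2 := by positivity
  linarith

lemma convex_feasibleSet_flow (hβ0 : 0 ≤ β θ) :
    Convex ℝ (feasibleSet (fun j ξ => flowConstraint α β g j ξ θ)) :=
  convex_feasibleSet_qcqp _ _ hβ0

/-- At a feasible θ the vector 0 is admissible in (R), so it can be tested in the variational
inequality for R(θ). -/
lemma inner_gradient_objective_flowField_le (hα : 0 < α) (hβ0 : 0 ≤ β θ)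
    (hθ : θ ∈ feasibleSet g) (h : SlaterCondition (fun j ξ => flowConstraint α β g j ξ θ)) :
    inner ℝ (gradient f θ) (flowField α β f g θ) ≤ -‖flowField α β f g θ‖ ^ 2 := by
  obtain ⟨h1, h2⟩ := flowField_spec (f := f) h
  have h0 : (0 : E) ∈ feasibleSet (fun j ξ => flowConstraint α β g j ξ θ) := fun j => by
    simpa [flowConstraint, qcqpConstraint] using
      mul_nonpos_of_nonneg_of_nonpos hα.le (hθ j)
  have h3 := inner_nonneg_of_forall_norm_le (convex_feasibleSet_flow hβ0) h1 h2 h0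
  rw [zero_sub, inner_neg_right, inner_add_left, real_inner_self_eq_norm_sq] at h3
  linarith

/-- The zeros of the flow field are KKT points. -/
lemma isKKTPoint_of_flowField_eq_zero [Fintype ι] (hα : 0 < α) (hβ0 : 0 ≤ β θ)
    (hmfcq : θ ∈ feasibleSet g → MFCQ g θ)
    (h : SlaterCondition (fun j ξ => flowConstraint α β g j ξ θ))
    (hzero : flowField α β f g θ = 0) : IsKKTPoint f g θ := by
  classical
  obtain ⟨h1, h2⟩ := flowField_spec (f := f) h
  rw [hzero] at h1 h2
  have hθ : θ ∈ feasibleSet g := fun j => by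
    have := h1 j
    simp only [flowConstraint, qcqpConstraint, inner_zero_right, norm_zero] at this
    exact nonpos_of_mul_nonpos_right (by linarith) hα
  obtain ⟨ξ₀, hξ₀⟩ := hmfcq hθ
  -- Gordan's alternative for the objective and active gradients yields Fritz John multipliers;
  -- `none` labels the objective.
  let y : Option {j // g j θ = 0} → E := fun i => i.elim (gradient f θ) fun j => gradient (g j) θ
  rcases exists_forall_inner_neg_or_exists_weights y with ⟨ξ, hξ⟩ | ⟨w, hw0, hw1, hw⟩
  · exfalso
    obtain ⟨t, ht, htpos⟩ := ((eventually_qcqpConstraint_smul_neg (a := fun k => α * g k θ)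
      (v := fun k => gradient (g k) θ) (β θ) (ξ := ξ)
      (fun j => mul_nonpos_of_nonneg_of_nonpos hα.le (hθ j))
      (fun j hj => hξ (some ⟨j, (mul_eq_zero.1 hj).resolve_left hα.ne'⟩))).and
      self_mem_nhdsWithin).exists
    have htpos' : (0 : ℝ) < t := htpos
    have h3 := inner_nonneg_of_forall_norm_le (convex_feasibleSet_flow hβ0) h1 h2
      (ξ := t • ξ) (fun j => (ht j).le)
    rw [add_zero, sub_zero, inner_smul_right] at h3
    exact absurd h3 (not_le.2 (mul_neg_of_pos_of_neg htpos' (hξ none)))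
  · rw [Fintype.sum_option] at hw hw1
    -- If the objective had weight zero, pairing the relation with the MFCQ direction ξ₀ would make
    -- all weights vanish.
    have hpos : 0 < w none := by
      refine (hw0 none).lt_of_ne fun hn => ?_
      rw [← hn, zero_smul, zero_add] at hw
      have h3 : ∑ j : {j // g j θ = 0}, w (some j) * inner ℝ (gradient (g j) θ) ξ₀ = 0 := by
        have := congrArg (fun z => inner ℝ z ξ₀) hw
        simpa [sum_inner, inner_smul_left, y] using this
      have h4 : ∀ j : {j // g j θ = 0}, w (some j) = 0 := by
        have h5 := (Finset.sum_eq_zero_iff_of_nonpos fun (j : {j // g j θ = 0}) _ =>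
          mul_nonpos_of_nonneg_of_nonpos (hw0 (some j)) (hξ₀ j j.2).le).1 h3
        exact fun j => (mul_eq_zero.1 (h5 j (Finset.mem_univ _))).resolve_right (hξ₀ j j.2).ne
      simp [← hn, h4] at hw1
    refine ⟨fun j => if hj : g j θ = 0 then w (some ⟨j, hj⟩) / w none else 0, ?_, fun j =>
      ⟨hθ j, ?_, ?_⟩⟩
    · have h3 : ∑ j, (if hj : g j θ = 0 then w (some ⟨j, hj⟩) / w none else 0) •
          gradient (g j) θ = ∑ j : {j // g j θ = 0}, (w (some j) / w none) • gradient (g j) θ := by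
        rw [← Fintype.sum_subtype_add_sum_subtype (fun j => g j θ = 0)]
        have h4 : ∀ j : {j // ¬g j θ = 0}, (if hj : g j θ = 0 then w (some ⟨j, hj⟩) / w none
            else 0) • gradient (g j) θ = 0 := fun j => by rw [dif_neg j.2, zero_smul]
        rw [Finset.sum_eq_zero fun j _ => h4 j, add_zero]
        exact Finset.sum_congr rfl fun j _ => by rw [dif_pos j.2]
      rw [h3]
      have h5 : w none • (gradient f θ +
          ∑ j : {j // g j θ = 0}, (w (some j) / w none) • gradient (g j) θ) = 0 := by
        rw [smul_add, Finset.smul_sum, ← hw]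
        congr 1
        refine Finset.sum_congr rfl fun j _ => ?_
        rw [smul_smul, mul_div_cancel₀ _ hpos.ne']
        rfl
      exact (smul_eq_zero.1 h5).resolve_left hpos.ne'
    · dsimp only
      split_ifs with hj
      · exact div_nonneg (hw0 _) hpos.le
      · exact le_rfl
    · dsimp only
      split_ifs with hj
      · rw [hj, mul_zero]
      · rw [zero_mul]

end Flow

/-! ### Perturbed Euler schemes with a Lyapunov function -/

section Dynamics

lemma le_sub_mul_of_step {x h : ℕ → ℝ} {c : ℝ} {N n : ℕ} (hNn : N ≤ n)
    (hx : ∀ i, N ≤ i → i < n → x (i + 1) ≤ x i - c * h i) :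
    x n ≤ x N - c * (∑ i ∈ Finset.range n, h i - ∑ i ∈ Finset.range N, h i) := by
  induction n, hNn using Nat.le_induction with
  | base => simp
  | succ n hn ih =>
    have h1 := ih fun i hi hin => hx i hi (hin.trans n.lt_succ_self)
    have h2 := hx n hn n.lt_succ_self
    rw [Finset.sum_range_succ]
    linarith

/-- Asymptotic nonpositivity for a perturbed linear recursion. -/
lemma eventually_le_of_recursion {x h ε : ℕ → ℝ} {α δ : ℝ} (hα : 0 < α) (hδ : 0 < δ)
    (hpos : ∀ i, 0 < h i) (hh : Tendsto h atTop (𝓝 0))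
    (hsum : Tendsto (fun n => ∑ i ∈ Finset.range n, h i) atTop atTop)
    (hε : Tendsto ε atTop (𝓝 0)) (hx : ∀ i, x (i + 1) ≤ x i - α * h i * x i + h i * ε i) :
    ∀ᶠ i in atTop, x i ≤ δ := by
  obtain ⟨N, hN⟩ := eventually_atTop.1 ((hε.eventually_lt_const
    (by positivity : 0 < α * (δ / 2))).and (hh.eventually_lt_const (by positivity : 0 < 1 / α)))
  -- Once the error is below αδ/2, the excess over δ/2 contracts; staying above δ forever would mean
  -- a decrease proportional to the divergent sum of the steps.
  have hstep : ∀ i, N ≤ i → x (i + 1) - δ / 2 ≤ (1 - α * h i) * (x i - δ / 2) := by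
    intro i hi
    have := mul_le_mul_of_nonneg_left (hN i hi).1.le (hpos i).le
    have := hx i
    nlinarith
  have hcoef : ∀ i, N ≤ i → 0 ≤ 1 - α * h i := by
    intro i hi
    have := (hN i hi).2
    rw [lt_div_iff₀ hα] at this
    linarith
  obtain ⟨m, hm, hxm⟩ : ∃ m, N ≤ m ∧ x m ≤ δ := by
    by_contra! hcon
    have hdec : ∀ n, N ≤ n → x n ≤ x N - α * (δ / 2) *
        (∑ i ∈ Finset.range n, h i - ∑ i ∈ Finset.range N, h i) := by
      intro n hn
      refine le_sub_mul_of_step hn fun i hi _ => ?_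
      have h1 := hstep i hi
      have h2 := mul_le_mul_of_nonneg_left (hcon i hi).le (mul_pos hα (hpos i)).le
      nlinarith
    obtain ⟨n, hn, hn'⟩ := ((hsum.eventually_gt_atTop
      (x N / (α * (δ / 2)) + ∑ i ∈ Finset.range N, h i)).and (eventually_ge_atTop N)).exists
    have h1 := hdec n hn'
    have h2 := hcon n hn'
    have h3 : x N < α * (δ / 2) * (∑ i ∈ Finset.range n, h i - ∑ i ∈ Finset.range N, h i) := by
      rw [← div_lt_iff₀' (by positivity)]
      linarith
    linarith
  filter_upwards [eventually_ge_atTop m] with n hn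
  induction n, hn using Nat.le_induction with
  | base => exact hxm
  | succ n hn ih =>
    have h1 := hstep n (hm.trans hn)
    have h2 := hcoef n (hm.trans hn)
    have h3 := mul_le_mul_of_nonneg_left (by linarith : x n - δ / 2 ≤ δ / 2) h2
    have h4 := mul_pos (mul_pos hα (hpos n)) hδ
    nlinarith

variable {E : Type*}

/-- By compactness, infinitely many terms outside U would have a cluster point in s. Neighbourhoods
relative to s suffice because the sequence lives there. -/
lemma eventually_mem_of_forall_mapClusterPt [TopologicalSpace E] {s U : Set E} {θ : ℕ → E}
    (hs : IsCompact s) (hθ : ∀ i, θ i ∈ s)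
    (hU : ∀ p ∈ s, MapClusterPt p atTop θ → U ∈ 𝓝[s] p) : ∀ᶠ i in atTop, θ i ∈ U := by
  by_contra hcon
  have hne : (atTop ⊓ 𝓟 {i | θ i ∉ U}).NeBot := 
    frequently_mem_iff_neBot.1 (not_eventually.1 hcon)
  set u := Ultrafilter.of (atTop ⊓ 𝓟 {i | θ i ∉ U})
  have hu : (u : Filter ℕ) ≤ atTop ⊓ 𝓟 {i | θ i ∉ U} := Ultrafilter.of_le _
  have hus : Tendsto θ u (𝓟 s) := tendsto_principal.2 (Eventually.of_forall hθ)
  obtain ⟨p, hp, hup⟩ := hs.ultrafilter_le_nhds (u.map θ) hus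
  have h1 := hU p hp (mapClusterPt_iff_ultrafilter.2 ⟨u, hu.trans inf_le_left, hup⟩)
  have h2 : Tendsto θ u (𝓝[s] p) := tendsto_inf.2 ⟨hup, hus⟩
  have h3 : ∀ᶠ i in (u : Filter ℕ), θ i ∈ U := h2 h1
  have h4 : ∀ᶠ i in (u : Filter ℕ), θ i ∉ U := hu (mem_inf_of_right (mem_principal_self _))
  obtain ⟨i, hi, hi'⟩ := (h3.and h4).exists
  exact hi' hi

variable [NormedAddCommGroup E]

/-- First order expansion of a `C¹` function along a perturbed Euler scheme. -/
lemma tendsto_div_step_sub_inner [InnerProductSpace ℝ E] [FiniteDimensional ℝ E] {s : Set E}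
    (hs : IsCompact s) (hsc : Convex ℝ s) {R : E → E} (hR : ContinuousOn R s) {θ D : ℕ → E}
    {h : ℕ → ℝ} (hθ : ∀ i, θ i ∈ s)
    (hpos : ∀ i, 0 < h i) (hh : Tendsto h atTop (𝓝 0))
    (hstep : ∀ i, θ (i + 1) = θ i + h i • D i)
    (hD : Tendsto (fun i => ‖R (θ i) - D i‖) atTop (𝓝 0)) {f : E → ℝ} (hf : ContDiff ℝ 1 f) :
    Tendsto (fun i => (f (θ (i + 1)) - f (θ i)) / h i - inner ℝ (gradient f (θ i)) (R (θ i)))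
      atTop (𝓝 0) := by
  obtain ⟨M, hM⟩ := hs.exists_bound_of_continuousOn hR
  obtain ⟨G, hG⟩ := hs.exists_bound_of_continuousOn (continuous_gradient hf).continuousOn
  have hM0 : 0 ≤ M := (norm_nonneg _).trans (hM _ (hθ 0))
  have hDM : ∀ᶠ i in atTop, ‖D i‖ ≤ M + 1 := by
    filter_upwards [hD.eventually_lt_const one_pos] with i hi
    have h1 := norm_sub_norm_le (D i) (R (θ i))
    rw [norm_sub_rev] at h1
    have h2 := hM _ (hθ i)
    linarith
  have hsecond : Tendsto (fun i => inner ℝ (gradient f (θ i)) (D i - R (θ i))) atTop (𝓝 0) := by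
    refine squeeze_zero_norm (fun i => ?_) (by simpa using hD.const_mul G)
    rw [norm_sub_rev (R (θ i))]
    exact (norm_inner_le_norm _ _).trans (mul_le_mul_of_nonneg_right (hG _ (hθ i)) (norm_nonneg _))
  have hfirst : Tendsto (fun i => (f (θ (i + 1)) - f (θ i)) / h i -
      inner ℝ (gradient f (θ i)) (D i)) atTop (𝓝 0) := by
    rw [Metric.tendsto_nhds]
    intro ε hε
    -- Steps shrink, so uniform continuity of the derivative on s makes the mean value error o(h i);
    -- convexity keeps the segments in s.
    have huc := hs.uniformContinuousOn_of_continuous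
      (hf.continuous_fderiv one_ne_zero).continuousOn
    obtain ⟨δ, hδ, hδ'⟩ := Metric.uniformContinuousOn_iff.1 huc (ε / (2 * (M + 1)))
      (by positivity)
    filter_upwards [hDM, hh.eventually_lt_const (by positivity : 0 < δ / (M + 1))] with i h1 h2
    have hlen : ‖θ (i + 1) - θ i‖ = h i * ‖D i‖ := by
      rw [hstep, add_sub_cancel_left, norm_smul, Real.norm_eq_abs, abs_of_pos (hpos i)]
    have h3 : ‖θ (i + 1) - θ i‖ < δ := by
      rw [hlen]
      calc h i * ‖D i‖ ≤ h i * (M + 1) := mul_le_mul_of_nonneg_left h1 (hpos i).le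
        _ < δ := by rwa [lt_div_iff₀ (by positivity)] at h2
    have h4 : ∀ z ∈ segment ℝ (θ i) (θ (i + 1)),
        ‖fderiv ℝ f z - fderiv ℝ f (θ i)‖ ≤ ε / (2 * (M + 1)) := by
      intro z hz
      rw [← dist_eq_norm]
      refine (hδ' z (hsc.segment_subset (hθ i) (hθ (i + 1)) hz) (θ i) (hθ i) ?_).le
      rw [dist_eq_norm]
      exact (norm_sub_le_of_mem_segment hz).trans_lt h3
    have h5 := (convex_segment (θ i) (θ (i + 1))).norm_image_sub_le_of_norm_fderiv_le'
      (𝕜 := ℝ) (f := f) (fun z _ => hf.differentiable one_ne_zero z) h4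
      (left_mem_segment ℝ _ _) (right_mem_segment ℝ _ _)
    have h6 : fderiv ℝ f (θ i) (θ (i + 1) - θ i) = h i * inner ℝ (gradient f (θ i)) (D i) := by
      rw [hstep, add_sub_cancel_left, map_smul, inner_gradient, smul_eq_mul]
    rw [h6, hlen] at h5
    have h7 : (f (θ (i + 1)) - f (θ i)) / h i - inner ℝ (gradient f (θ i)) (D i) =
        (f (θ (i + 1)) - f (θ i) - h i * inner ℝ (gradient f (θ i)) (D i)) / h i := by
      rw [sub_div _ (h i * _), mul_div_cancel_left₀ _ (hpos i).ne']
    rw [dist_zero_right, h7, norm_div, Real.norm_eq_abs (h i), abs_of_pos (hpos i),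
      div_lt_iff₀ (hpos i)]
    have h8 : ε / (2 * (M + 1)) * (h i * ‖D i‖) ≤ ε / (2 * (M + 1)) * (h i * (M + 1)) :=
      mul_le_mul_of_nonneg_left (mul_le_mul_of_nonneg_left h1 (hpos i).le) (by positivity)
    have h9 : ε / (2 * (M + 1)) * (h i * (M + 1)) = ε / 2 * h i := by
      field_simp
    have h10 := mul_pos hε (hpos i)
    linarith
  have := hfirst.add hsecond
  rw [add_zero] at this
  refine this.congr fun i => ?_
  rw [inner_sub_right]
  ring

/-- A scheme whose objective values converge, and decrease away from the zeros of `R`, can only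
accumulate at the zeros of `R`. -/
lemma eq_zero_of_mapClusterPt {s : Set E} {R : E → E} (hR : ContinuousOn R s) {θ : ℕ → E}
    {h x : ℕ → ℝ} {M ℓ : ℝ} (hM : 0 < M) (hθ : ∀ i, θ i ∈ s)
    (hsum : Tendsto (fun n => ∑ i ∈ Finset.range n, h i) atTop atTop)
    (hspeed : ∀ᶠ i in atTop, ‖θ (i + 1) - θ i‖ ≤ h i * M)
    (hdesc : ∀ ε > 0, ∀ᶠ i in atTop, x (i + 1) ≤ x i - (‖R (θ i)‖ ^ 2 - ε) * h i)
    (hpos : ∀ i, 0 < h i) (hx : Tendsto x atTop (𝓝 ℓ)) {p : E} (hps : p ∈ s)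
    (hp : MapClusterPt p atTop θ) : R p = 0 := by
  by_contra hRp
  have hδ0 : 0 < ‖R p‖ ^ 2 := by positivity
  set δ := ‖R p‖ ^ 2 / 4 with hδ
  have hδpos : 0 < δ := by positivity
  have hnear : ∀ᶠ z in 𝓝[s] p, 2 * δ < ‖R z‖ ^ 2 := by
    have h1 : Tendsto (fun z => ‖R z‖ ^ 2) (𝓝[s] p) (𝓝 (‖R p‖ ^ 2)) := (hR p hps).norm.pow 2
    exact h1.eventually_const_lt (by rw [hδ]; linarith)
  obtain ⟨r, hr, hball⟩ := Metric.mem_nhdsWithin_iff.1 hnear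
  -- Chosen so that an oscillation of 2η, consumed at rate δ, allows time at most r/(4M), hence
  -- displacement at most r/4.
  set η := δ * r / (8 * M) with hη
  have hηpos : 0 < η := by positivity
  obtain ⟨N, hN⟩ := eventually_atTop.1 ((hspeed.and (hdesc δ hδpos)).and
    ((hx.eventually_lt_const (lt_add_of_pos_right ℓ hηpos)).and
      (hx.eventually_const_lt (sub_lt_self ℓ hηpos))))
  obtain ⟨m, hm, hmN⟩ := ((hp.frequently (Metric.ball_mem_nhds p (half_pos hr))).and_eventually
    (eventually_ge_atTop N)).exists
  set H : ℕ → ℝ := fun n => ∑ i ∈ Finset.range n, h i with hH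
  have hval : ∀ n, m ≤ n → x n ≤ x m - δ * (H n - H m) → H n - H m ≤ r / (4 * M) := by
    intro n hn h1
    have h2 := (hN n (hmN.trans hn)).2.2
    have h3 := (hN m hmN).2.1
    have h4 : δ * (H n - H m) ≤ δ * (r / (4 * M)) := by
      have : δ * (r / (4 * M)) = 2 * η := by rw [hη]; field_simp; ring
      linarith
    exact le_of_mul_le_mul_left h4 hδpos
  -- Bootstrap: starting within r/2 of p and moving at most r/4, the scheme never leaves the ball of
  -- radius r, so the descent persists and elapsed time stays bounded.
  have hind : ∀ n, m ≤ n → x n ≤ x m - δ * (H n - H m) ∧ ‖θ n - θ m‖ ≤ M * (H n - H m) := by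
    intro n hn
    induction n, hn using Nat.le_induction with
    | base => simp
    | succ n hn ih =>
      have h1 := mul_le_mul_of_nonneg_left (hval n hn ih.1) hM.le
      have h2 : M * (r / (4 * M)) = r / 4 := by field_simp
      have h3 : θ n ∈ Metric.ball p r ∩ s := by
        refine ⟨?_, hθ n⟩
        have h4 := dist_triangle (θ n) (θ m) p
        rw [dist_eq_norm (θ n) (θ m)] at h4
        rw [Metric.mem_ball]
        linarith [ih.2]
      have h5 : 2 * δ < ‖R (θ n)‖ ^ 2 := hball h3
      have h6 := (hN n (hmN.trans hn)).1
      have hH1 : H (n + 1) = H n + h n := Finset.sum_range_succ _ _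
      rw [hH1]
      constructor
      · have h7 : δ * h n ≤ (‖R (θ n)‖ ^ 2 - δ) * h n :=
          mul_le_mul_of_nonneg_right (by linarith) (hpos n).le
        linarith [h6.2, ih.1]
      · have h8 := norm_add_le (θ (n + 1) - θ n) (θ n - θ m)
        rw [sub_add_sub_cancel] at h8
        linarith [h6.1, ih.2]
  obtain ⟨n, hn, hn'⟩ := ((hsum.eventually_gt_atTop (H m + r / (4 * M))).and
    (eventually_ge_atTop m)).exists
  have := hval n hn' (hind n hn').1
  have hn2 : H m + r / (4 * M) < H n := hn
  linarith

/-- If the values at the zeros of `R` have empty interior, then the objective converges along the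
scheme. -/
lemma exists_tendsto_objective {s : Set E} (hs : IsCompact s) {R : E → E} (hR : ContinuousOn R s)
    {θ : ℕ → E} {h : ℕ → ℝ} {f : E → ℝ} (hf : Continuous f) (hθ : ∀ i, θ i ∈ s)
    (hdesc : ∀ ε > 0, ∀ᶠ i in atTop, f (θ (i + 1)) ≤ f (θ i) - (‖R (θ i)‖ ^ 2 - ε) * h i)
    (hpos : ∀ i, 0 < h i) (hh : Tendsto h atTop (𝓝 0))
    (hint : interior (f '' {z ∈ s | R z = 0}) = ∅) :
    ∃ ℓ, Tendsto (fun i => f (θ i)) atTop (𝓝 ℓ) := by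
  set Z := {z ∈ s | R z = 0} with hZ
  have hZc : IsCompact Z := by
    have : IsClosed (s ∩ R ⁻¹' {0}) := 
      hR.preimage_isClosed_of_isClosed hs.isClosed isClosed_singleton
    exact hs.of_isClosed_subset this fun z hz => hz.1
  have hfZ : IsClosed (f '' Z) := (hZc.image hf).isClosed
  obtain ⟨B, hB⟩ := hs.exists_bound_of_continuousOn hf.continuousOn
  refine tendsto_of_no_upcrossings dense_univ ?_ ?_ ?_
  · rintro a - b - hab ⟨hfa, hfb⟩
    -- The values on Z form a closed set with empty interior, so (a, b) contains a closed interval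
    -- [c - r, c + r] avoiding them.
    obtain ⟨c, hc, hcab⟩ : ∃ c, c ∈ (f '' Z)ᶜ ∧ c ∈ Set.Ioo a b :=
      ((interior_eq_empty_iff_dense_compl.1 hint).inter_open_nonempty _ isOpen_Ioo
        (Set.nonempty_Ioo.2 hab)).imp fun c hc => ⟨hc.2, hc.1⟩
    obtain ⟨r, hr, hball⟩ := Metric.nhds_basis_closedBall.mem_iff.1
      (inter_mem (hfZ.isOpen_compl.mem_nhds hc) (isOpen_Ioo.mem_nhds hcab))
    rw [Real.closedBall_eq_Icc] at hball
    have hT : IsCompact (s ∩ f ⁻¹' Set.Icc (c - r) (c + r)) :=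
      hs.inter_right (isClosed_Icc.preimage hf)
    obtain ⟨δ, hδ, hTδ⟩ := hT.exists_forall_le' (f := fun z => ‖R z‖ ^ 2) (a := 0)
      ((hR.mono Set.inter_subset_left).norm.pow 2) (fun z hz => by
        have : R z ≠ 0 := fun h0 => (hball hz.2).1 ⟨z, ⟨hz.1, h0⟩, rfl⟩
        positivity)
    have hca : a < c - r := (hball ⟨le_rfl, by linarith⟩).2.1
    have hcb : c + r < b := (hball ⟨by linarith, le_rfl⟩).2.2
    obtain ⟨N, hN⟩ := eventually_atTop.1 (((hdesc δ hδ).and (hdesc 1 one_pos)).and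
      (hh.eventually_lt_const (by positivity : 0 < 2 * r)))
    obtain ⟨m, hm, hmN⟩ := (hfa.and_eventually (eventually_ge_atTop N)).exists
    -- From below c - r one step gains less than 2r; inside the gap ‖R‖² ≥ δ and the objective does
    -- not increase. So c + r is never exceeded.
    have hinv : ∀ n, m ≤ n → f (θ n) ≤ c + r := by
      intro n hn
      induction n, hn using Nat.le_induction with
      | base => linarith
      | succ n hn ih =>
        obtain ⟨⟨h1, h2⟩, h3⟩ := hN n (hmN.trans hn)
        rcases lt_or_ge (f (θ n)) (c - r) with h4 | h4
        · have := mul_nonneg (sq_nonneg ‖R (θ n)‖) (hpos n).le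
          linarith
        · have h5 : δ ≤ ‖R (θ n)‖ ^ 2 := hTδ (θ n) ⟨hθ n, h4, ih⟩
          have := mul_nonneg (sub_nonneg.2 h5) (hpos n).le
          linarith
    obtain ⟨n, hn, hn'⟩ := (hfb.and_eventually (eventually_ge_atTop m)).exists
    linarith [hinv n hn']
  · exact isBoundedUnder_of ⟨B, fun i => (Real.le_norm_self _).trans (hB _ (hθ i))⟩
  · exact isBoundedUnder_of ⟨-B, fun i => (abs_le.1 (hB _ (hθ i))).1⟩

/-- A perturbed Euler scheme for a field that dissipates the constraint functions, and the
objective at the feasible points, converges to the zeros of the field. -/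
theorem tendsto_infEDist_zeros [InnerProductSpace ℝ E] [FiniteDimensional ℝ E] {ι : Type*}
    {s : Set E} (hs : IsCompact s) (hsc : Convex ℝ s) {R : E → E} (hR : ContinuousOn R s) {θ D : ℕ → E}
    {h : ℕ → ℝ}
    (hθ : ∀ i, θ i ∈ s) (hpos : ∀ i, 0 < h i) (hh : Tendsto h atTop (𝓝 0))
    (hsum : Tendsto (fun n => ∑ i ∈ Finset.range n, h i) atTop atTop)
    (hstep : ∀ i, θ (i + 1) = θ i + h i • D i)
    (hD : Tendsto (fun i => ‖R (θ i) - D i‖) atTop (𝓝 0))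
    {f : E → ℝ} (hf : ContDiff ℝ 1 f) {g : ι → E → ℝ} (hg : ∀ j, ContDiff ℝ 1 (g j))
    {α : ℝ} (hα : 0 < α)
    (hgR : ∀ z ∈ s, ∀ j, inner ℝ (gradient (g j) z) (R z) ≤ -(α * g j z))
    (hfR : ∀ z ∈ s, z ∈ feasibleSet g → inner ℝ (gradient f z) (R z) ≤ -‖R z‖ ^ 2)
    (hint : interior (f '' {z ∈ s | R z = 0}) = ∅) :
    Tendsto (fun i => Metric.infEDist (θ i) {z ∈ s | R z = 0}) atTop (𝓝 0) := by
  have hexp := fun {φ : E → ℝ} (hφ : ContDiff ℝ 1 φ) =>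
    tendsto_div_step_sub_inner hs hsc hR hθ hpos hh hstep hD hφ
  have hexp_eq : ∀ (φ : E → ℝ) i, φ (θ (i + 1)) = φ (θ i) + h i *
      ((φ (θ (i + 1)) - φ (θ i)) / h i - inner ℝ (gradient φ (θ i)) (R (θ i))) +
      h i * inner ℝ (gradient φ (θ i)) (R (θ i)) := by
    intro φ i
    rw [mul_sub, mul_div_cancel₀ _ (hpos i).ne']
    ring
  have hclus : ∀ p, MapClusterPt p atTop θ → p ∈ feasibleSet g := by
    intro p hp j
    refine le_of_forall_pos_le_add fun δ hδ => ?_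
    rw [zero_add]
    have h1 : ∀ᶠ i in atTop, θ i ∈ g j ⁻¹' Set.Iic δ := by
      refine eventually_le_of_recursion (x := fun i => g j (θ i)) hα hδ hpos hh hsum
        (hexp (hg j)) fun i => ?_
      have h2 := hexp_eq (g j) i
      have h3 := mul_le_mul_of_nonneg_left (hgR _ (hθ i) j) (hpos i).le
      linarith
    exact (isClosed_Iic.preimage (hg j).continuous).mem_of_mapClusterPt hp h1
  have hdesc : ∀ ε > 0, ∀ᶠ i in atTop,
      f (θ (i + 1)) ≤ f (θ i) - (‖R (θ i)‖ ^ 2 - ε) * h i := by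
    intro ε hε
    -- The dissipation inequality is known only at feasible points, but all cluster points are
    -- feasible, so by continuity it holds eventually up to ε/2.
    have h1 : ∀ᶠ i in atTop,
        θ i ∈ {z | inner ℝ (gradient f z) (R z) + ‖R z‖ ^ 2 < ε / 2} := by
      refine eventually_mem_of_forall_mapClusterPt hs hθ fun p hp hpc => ?_
      have h2 : Tendsto (fun z => inner ℝ (gradient f z) (R z) + ‖R z‖ ^ 2) (𝓝[s] p)
          (𝓝 (inner ℝ (gradient f p) (R p) + ‖R p‖ ^ 2)) :=
        (((continuous_gradient hf).continuousWithinAt.tendsto).inner (hR p hp)).add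
          ((hR p hp).norm.pow 2)
      refine h2.eventually_lt_const ?_
      have := hfR p hp (hclus p hpc)
      linarith
    filter_upwards [h1, (hexp hf).eventually_lt_const (half_pos hε)] with i h2 h3
    have h2' : inner ℝ (gradient f (θ i)) (R (θ i)) + ‖R (θ i)‖ ^ 2 < ε / 2 := h2
    have h4 := hexp_eq f i
    have h5 := mul_le_mul_of_nonneg_left h3.le (hpos i).le
    have h6 := mul_le_mul_of_nonneg_left h2'.le (hpos i).le
    linarith
  obtain ⟨ℓ, hℓ⟩ := exists_tendsto_objective hs hR hf.continuous hθ hdesc hpos hh hint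
  obtain ⟨M, hM⟩ := hs.exists_bound_of_continuousOn hR
  have hM0 : 0 ≤ M := (norm_nonneg _).trans (hM _ (hθ 0))
  have hspeed : ∀ᶠ i in atTop, ‖θ (i + 1) - θ i‖ ≤ h i * (M + 1) := by
    filter_upwards [hD.eventually_lt_const one_pos] with i hi
    have h1 := norm_sub_norm_le (D i) (R (θ i))
    rw [norm_sub_rev] at h1
    have h2 := hM _ (hθ i)
    rw [hstep, add_sub_cancel_left, norm_smul, Real.norm_eq_abs, abs_of_pos (hpos i)]
    exact mul_le_mul_of_nonneg_left (by linarith) (hpos i).le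
  rw [ENNReal.tendsto_nhds_zero]
  intro ε hε
  have h1 : ∀ᶠ i in atTop, θ i ∈ {z | Metric.infEDist z {z ∈ s | R z = 0} < ε} := by
    refine eventually_mem_of_forall_mapClusterPt hs hθ fun p hp hpc => ?_
    have hz := eq_zero_of_mapClusterPt hR (by linarith : 0 < M + 1) hθ hsum hspeed hdesc hpos hℓ
      hp hpc
    refine mem_nhdsWithin_of_mem_nhds ?_
    refine (isOpen_lt Metric.continuous_infEDist continuous_const).mem_nhds ?_
    change Metric.infEDist p _ < ε
    rwa [Metric.infEDist_zero_of_mem (show p ∈ {z ∈ s | R z = 0} from ⟨hp, hz⟩)]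
  filter_upwards [h1] with i hi using le_of_lt hi

end Dynamics

/-! ### Convergence of the algorithm -/

namespace RLProblem

variable {d q : ℕ} {S A L : Type*} [MeasurableSpace S] [MeasurableSpace A]
  {P : RLProblem d q S A}

lemma contDiff_constraint {β : EuclideanSpace ℝ (Fin d) → ℝ} (h : P.Regularity β) (C : ℝ)
    (j : Fin (q + 1)) : ContDiff ℝ 2 (P.constraint C j) := by
  refine Fin.lastCases ?_ (fun j => ?_) j
  · simpa [constraint] using (contDiff_norm_sq ℝ).sub contDiff_const
  · simpa [constraint] using h.1 j.succ

lemma constraint_last (P : RLProblem d q S A) (C : ℝ) :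
    P.constraint C (Fin.last q) = fun θ => ‖θ‖ ^ 2 - C := by
  simp [constraint]

lemma constraint_castSucc (P : RLProblem d q S A) (C : ℝ) (j : Fin q) :
    P.constraint C j.castSucc = P.value j.succ := by
  simp [constraint]

lemma inner_gradient_norm_sq_sub (C : ℝ) (θ ξ : EuclideanSpace ℝ (Fin d)) :
    inner ℝ (gradient (fun x : EuclideanSpace ℝ (Fin d) => ‖x‖ ^ 2 - C) θ) ξ =
      2 * inner ℝ θ ξ := by
  rw [inner_gradient, ((hasStrictFDerivAt_norm_sq θ).hasFDerivAt.sub_const C).fderiv]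
  simp [two_mul]

/-- The ball `Θ` is invariant under a step of the algorithm. -/
lemma Params.norm_sq_add_smul_stepDirection_le (Q : P.Params L)
    (ep : Q.Label → Episode S A P.horizon) (θ : ℕ → EuclideanSpace ℝ (Fin d))
    (J : Finset Q.Label) (i : ℕ) (hθ : ‖θ i‖ ^ 2 ≤ Q.C)
    (hfeas : (feasibleSet (Q.stepConstraint ep θ J i)).Nonempty)
    (hα : Q.h i ≤ 1 / Q.α) (hβ : Q.h i ≤ Q.β (θ i) / 2) :
    ‖θ i + Q.h i • Q.stepDirection ep θ J i‖ ^ 2 ≤ Q.C := by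
  have hmem : Q.stepDirection ep θ J i ∈ feasibleSet (Q.stepConstraint ep θ J i) :=
    (argminOver_half_sq_spec (isClosed_feasibleSet_qcqp _ _ _) hfeas).1
  have h1 := hmem (Fin.last q)
  simp only [Params.stepConstraint, estimatedConstraint, qcqpConstraint, Fin.snoc_last,
    inner_gradient_norm_sq_sub] at h1
  set ξ := Q.stepDirection ep θ J i
  have hh := Q.h_pos i
  have h2 : Q.h i * Q.α ≤ 1 := by rwa [le_div_iff₀ Q.α_pos] at hα
  rw [norm_add_sq_real, inner_smul_right, norm_smul, Real.norm_eq_abs, abs_of_pos hh, mul_pow]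
  -- In the expansion of ‖θ + hξ‖² - C, the ball constraint times h leaves (1 - hα)(‖θ‖² - C) + h(h
  -- - β/2)‖ξ‖², and both terms are nonpositive.
  have h3 := mul_nonpos_of_nonneg_of_nonpos hh.le h1
  have h4 := mul_nonpos_of_nonneg_of_nonpos (by linarith : 0 ≤ 1 - Q.h i * Q.α)
    (by linarith : ‖θ i‖ ^ 2 - Q.C ≤ 0)
  have h5 := mul_le_mul_of_nonneg_right hβ (mul_nonneg hh.le (sq_nonneg ‖ξ‖))
  linarith

/-- Complementary slackness kills the multiplier of the inactive ball constraint. -/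
lemma isKKTPoint_of_mem_kktSet {C : ℝ} {x : EuclideanSpace ℝ (Fin d)} (hx : x ∈ P.kktSet C)
    (hxC : ‖x‖ ^ 2 < C) : IsKKTPoint (P.value 0) (fun j : Fin q => P.value j.succ) x := by
  obtain ⟨u, hu, hc⟩ := hx
  have hlast : u (Fin.last q) = 0 := by
    have h1 := (hc (Fin.last q)).2.2
    rw [constraint_last] at h1
    exact (mul_eq_zero.1 h1).resolve_right (by linarith)
  refine ⟨fun j => u j.castSucc, ?_, fun j => ?_⟩
  · rw [Fin.sum_univ_castSucc, hlast, zero_smul, add_zero] at hu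
    simpa only [constraint_castSucc] using hu
  · simpa only [constraint_castSucc] using hc j.castSucc

lemma slaterCondition_flowConstraint {Q : P.Params L}
    (hfeasCQ : P.FeasibleQualification Q.α Q.β Q.C)
    (hinfeasCQ : P.InfeasibleQualification Q.α Q.β Q.C) {θ : EuclideanSpace ℝ (Fin d)}
    (hθ : ‖θ‖ ^ 2 ≤ Q.C) :
    SlaterCondition (fun j ξ => flowConstraint Q.α Q.β (P.constraint Q.C) j ξ θ) := by
  by_cases h : θ ∈ feasibleSet (P.constraint Q.C)
  · exact slaterCondition_of_mfcq Q.α_pos h (hfeasCQ θ h).1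
  · exact (hinfeasCQ θ hθ h).1

lemma interior_value_image_kktSet_eq_empty {β : EuclideanSpace ℝ (Fin d) → ℝ}
    (h : P.Regularity β) (C : ℝ)
    (hcrit : 3 ≤ d → interior (P.value 0 '' P.kktSet C) = ∅) :
    interior (P.value 0 '' P.kktSet C) = ∅ := by
  rcases le_or_gt 3 d with hd | hd
  · exact hcrit hd
  · refine interior_image_kkt_eq_empty (h.1 0) (contDiff_constraint h C) ?_
    rw [finrank_euclideanSpace_fin]
    omega

end RLProblem

end RSGF

/-- Since `Metric.infEDist` to the empty set is ⊤, convergence to 0 also contains the nonemptiness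
of the KKT set. -/
theorem mainTheorem2 {d q : ℕ} {S A L Ω : Type*} [MeasurableSpace S] [MeasurableSpace A]
    [mΩ : MeasurableSpace Ω] (P : RSGF.RLProblem d q S A) (Q : P.Params L)
    (μ : Measure Ω) [IsProbabilityMeasure μ] (ℱ : Filtration ℕ mΩ)
    (ep : Q.Label → Ω → RSGF.Episode S A P.horizon)
    (J : ℕ → Ω → Finset Q.Label) (θ : ℕ → Ω → EuclideanSpace ℝ (Fin d))
    (hrun : RSGF.RLProblem.IsRun Q μ ℱ ep J θ)
    (hreg : P.Regularity Q.β)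
    (hfeasCQ : P.FeasibleQualification Q.α Q.β Q.C)
    (hpol : P.PoliciesBoundedBelow Q.Λ)
    (hrew : P.BoundedRewards)
    (hlog : P.RegularPolicies)
    (hinit : ‖Q.θ₀‖ ^ 2 - Q.C ≤ 0)
    (hinfeasCQ : P.InfeasibleQualification Q.α Q.β Q.C)
    (hfeas : ∀ᵐ ω ∂μ, ∀ i, (RSGF.feasibleSet
      (Q.stepConstraint (fun z => ep z ω) (fun k => θ k ω) (J i ω) i)).Nonempty)
    (hnoise : ∀ᵐ ω ∂μ, Tendsto (fun i => ‖Q.field (θ i ω) -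
      Q.stepDirection (fun z => ep z ω) (fun k => θ k ω) (J i ω) i‖) atTop (𝓝 0))
    (hh : Tendsto Q.h atTop (𝓝 0))
    (hsum : Tendsto (fun n => ∑ i ∈ Finset.range n, Q.h i) atTop atTop)
    (hstep : ∀ᵐ ω ∂μ, ∀ i, Q.h i ≤ 1 / Q.α ∧ Q.h i ≤ Q.β (θ i ω) / 2)
    (hcrit : 3 ≤ d → interior (P.value 0 '' P.kktSet Q.C) = ∅) :
    (∀ᵐ ω ∂μ, Tendsto (fun i => Metric.infEDist (θ i ω) (P.kktSet Q.C)) atTop (𝓝 0)) ∧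
      ∀ x ∈ P.kktSet Q.C, ‖x‖ ^ 2 < Q.C →
        RSGF.IsKKTPoint (P.value 0) (fun j : Fin q => P.value j.succ) x := by
  have hbound : ∀ x : EuclideanSpace ℝ (Fin d),
      x ∈ Metric.closedBall (0 : EuclideanSpace ℝ (Fin d)) (Real.sqrt Q.C) ↔ ‖x‖ ^ 2 ≤ Q.C :=
    fun x => by rw [mem_closedBall_zero_iff, Real.le_sqrt (norm_nonneg _) Q.C_pos.le]
  have hf : ContDiff ℝ 1 (P.value 0) := (hreg.1 0).of_le (by norm_num)
  have hg : ∀ j, ContDiff ℝ 1 (P.constraint Q.C j) := fun j =>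
    (RSGF.RLProblem.contDiff_constraint hreg Q.C j).of_le (by norm_num)
  have hslater := fun (x : EuclideanSpace ℝ (Fin d)) (hx : ‖x‖ ^ 2 ≤ Q.C) =>
    RSGF.RLProblem.slaterCondition_flowConstraint hfeasCQ hinfeasCQ hx
  have hZ : {z ∈ Metric.closedBall (0 : EuclideanSpace ℝ (Fin d)) (Real.sqrt Q.C) |
      Q.field z = 0} ⊆ P.kktSet Q.C := fun z hz =>
    RSGF.isKKTPoint_of_flowField_eq_zero Q.α_pos (Q.β_pos z).le (fun h => (hfeasCQ z h).1)
      (hslater z ((hbound z).1 hz.1)) hz.2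
  refine ⟨?_, fun x hx hxC => RSGF.RLProblem.isKKTPoint_of_mem_kktSet hx hxC⟩
  filter_upwards [hfeas, hnoise, hstep] with ω h1 h2 h3
  have hball : ∀ i, ‖θ i ω‖ ^ 2 ≤ Q.C := by
    intro i
    induction i with
    | zero =>
      rw [hrun.init]
      linarith
    | succ i ih =>
      rw [hrun.update]
      exact Q.norm_sq_add_smul_stepDirection_le _ (fun k => θ k ω) _ i ih (h1 i) (h3 i).1 (h3 i).2
  have hmain := RSGF.tendsto_infEDist_zeros (isCompact_closedBall 0 (Real.sqrt Q.C))
    (convex_closedBall 0 _) (R := Q.field) (θ := fun i => θ i ω)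
    (fun z hz => (RSGF.continuousAt_flowField hf hg hreg.2.continuous (Q.β_pos z).le
      (hslater z ((hbound z).1 hz))).continuousWithinAt)
    (fun i => (hbound _).2 (hball i)) Q.h_pos hh hsum (fun i => hrun.update i ω) h2 hf hg Q.α_pos
    (fun z hz j => RSGF.inner_gradient_constraint_flowField_le (Q.β_pos z).le
      (hslater z ((hbound z).1 hz)) j)
    (fun z hz hzf => RSGF.inner_gradient_objective_flowField_le Q.α_pos (Q.β_pos z).le hzf
      (hslater z ((hbound z).1 hz)))
    -- Only zeros of the field in Θ matter for the dynamics; they are KKT points, so their values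
    -- inherit the empty interior.
    (Set.subset_empty_iff.1 ((interior_mono (Set.image_mono hZ)).trans_eq
      (RSGF.RLProblem.interior_value_image_kktSet_eq_empty hreg Q.C hcrit)))
  exact tendsto_of_tendsto_of_tendsto_of_le_of_le tendsto_const_nhds hmain
    (fun _ => zero_le) (fun _ => Metric.infEDist_anti hZ)
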